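/- **Sequential data structures.** A game (sequential data structure) $A$ consists of a set $M_A$ of moves, a labelling $\lambda_A:M_A\to\{P,O\}$, and a non-empty prefix-closed set $P_A$ of plays. The plays are finite sequences in $M_A^{\circledast}$: alternating, without repeated moves, and starting with an $O$-move unless empty. Write $s\sqsubseteq t$ for "$s$ is a prefix of $t$", and $s\sqsubseteq^E t$ if $s$ is an even-length prefix of $t$ or $s=t$. A *sequential algorithm* (strategy) over $A$ is a non-empty $\sigma\subseteq P_A$ such that $s\sqsubseteq^E t\in\sigma$ implies $s\in\sigma$, and $s,t\in\sigma$ implies $s\sqcap t\sqsubseteq^E s$ and $s\sqcap t\sqsubseteq^E t$, where $s\sqcap t$ is the longest common prefix. Let $\mathrm{strat}(A)$ be the set of these, and let $E(\sigma)$ be the set of even-length elements of $\sigma$. For plays, $s\le^E t$ if ($s$ has even length and $s\sqsubseteq t$) or ($t$ has odd length and $t\sqsubseteq s$). For strategies, $\sigma\le^E\tau$ if $\forall s\in\sigma\,\exists t\in\tau.\ s\le^E t$, and $\sigma\updownarrow\tau$ if $E(\sigma)=E(\tau)$. **Bistable bicpos.** A *bistable biorder* is a partial order $(D,\le)$ with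 an equivalence relation $\updownarrow$ each of whose classes is a distributive lattice, whose binary meets and joins are also meets and joins in $D$. For directed sets, $X\updownarrow Y$ means that for all $x\in X$, $y\in Y$ there are $x'\in X$, $y'\in Y$ with $x\le x'$, $y\le y'$, $x'\updownarrow y'$. $D$ is a *bistable bicpo* if every (non-empty) directed set has a least upper bound, and $X\updownarrow Y$ implies $\bigsqcup X\updownarrow\bigsqcup Y$ and $\bigsqcup X\wedge\bigsqcup Y=\bigsqcup\{x\wedge y\mid x\in X,\,y\in Y,\,x\updownarrow y\}$. A function is *continuous* if it preserves directed least upper bounds, and *bistable* if it preserves $\updownarrow$ and the meets and joins of $\updownarrow$-related pairs. $\mathcal{BBC}$ is the category of bistable bicpos and continuous bistable functions. **Function space.** $A\multimap B$ has moves $M_A+M_B$, the labels of $A$ reversed and those of $B$ unchanged, and as plays the $t\in (M_A+M_B)^{\circledast}$ with $t\upharpoonright A\in P_A$ and $t\upharpoonright B\in P_B$. $!A$ has moves $P_A\setminus\{\varepsilon\}$, and $sa$ is labelled $\lambda_A(a)$. For a sequence $s$ of such moves let $|s|^E=\{\varepsilon\}\cup\{p\mid \exists t.\ tp\sqsubseteq^E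 s\}$. The plays of $!A$ are the $s\in M_{!A}^{\circledast}$ such that $|t|^E\in\mathrm{strat}(A)$ for every prefix $t$ of $s$, and in which every Player move immediately following an Opponent move $q$ has the form $qb$ for a single move $b$ of $A$. Put $A\Rightarrow B={!A}\multimap B$. For $\sigma\in\mathrm{strat}(A\Rightarrow B)$ and $\tau\in\mathrm{strat}(A)$ put $\sigma\cdot\tau=\{s\upharpoonright B\mid s\in\sigma,\ |s\upharpoonright{!A}|^E\subseteq\tau\}$. A function $f:\mathrm{strat}(A)\to\mathrm{strat}(B)$ is *observably sequential* if for some $\sigma\in\mathrm{strat}(A\Rightarrow B)$ one has $f(\tau)=\sigma\cdot\tau$ for all $\tau$; then $\sigma$ *computes* $f$. **Trace.** $\sigma\uparrow\tau$ means that $\sigma,\tau\subseteq\rho$ for some strategy $\rho$. Put $$\mathrm{tr}(f)=\{(\sigma,t)\mid t\in f(\sigma)\ \wedge\ \forall\tau.\,(\sigma\uparrow\tau\wedge t\in f(\tau)\Rightarrow\sigma\subseteq\tau)\},$$ $$\sigma_f=\{s\in P_{A\Rightarrow B}\mid\forall t\sqsubseteq^E s.\ (|t\upharpoonright{!A}|^E,\,t\upharpoonright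 B)\in\mathrm{tr}(f)\}.$$ **Theorem.** 1. Let $f:\mathrm{strat}(A)\to\mathrm{strat}(B)$ be continuous and bistable. Then: - $f$ is stable with respect to inclusion: it preserves least upper bounds of directed sets with respect to $\subseteq$, and $\sigma,\sigma'\subseteq\tau$ implies $f(\sigma\cap\sigma')=f(\sigma)\cap f(\sigma')$; - $\sigma_f$ is a sequential algorithm on $A\Rightarrow B$, and it computes $f$; - if $(\tau,tab)\in\mathrm{tr}(f)$ for some move $b$, or $(\tau,ta)\in\mathrm{tr}(f)$, where $t$ has even length, then either $(E(\tau),t)\in\mathrm{tr}(f)$ or there is a unique $pcd\in E(\tau)$ such that $(E(\tau)\setminus\{pcd\})\cup\{pc\}$ is a strategy and $((E(\tau)\setminus\{pcd\})\cup\{pc\},\,ta)\in\mathrm{tr}(f)$. 2. A function $\mathrm{strat}(A)\to\mathrm{strat}(B)$ is observably sequential if and only if it is continuous and bistable. Identities are observably sequential, and so are composites of observably sequential functions. 3. Each $(\mathrm{strat}(A),\le^E,\updownarrow)$ is a bistable bicpo. Together with 2, the SDS-biorders $\mathrm{strat}(A)$ and observably sequential functions form a full subcategory of $\mathcal{BBC}$.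 Moreover there are identities and a composition making sequential data structures, with the sequential algorithms on $A\Rightarrow B$ as morphisms $A\to B$, into a category, such that $A\mapsto\mathrm{strat}(A)$, $\sigma\mapsto(\tau\mapsto\sigma\cdot\tau)$ is a full and faithful functor into $\mathcal{BBC}$. -/

import Mathlib

universe u

open CategoryTheory

namespace Bistable

/-! ### Bistable biorders, bistable bicpos and the category they form -/

/-- `D` with its (extensional) partial order and the relation `coh` (bistable coherence) is a
bistable biorder: `coh` is an equivalence relation each of whose classes is a distributive
lattice, whose meets and joins are meets and joins in the whole of `D`. -/
structure IsBistableBiorder (D : Type u) [PartialOrder D] (coh : D → D → Prop) : Prop where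
  equiv : Equivalence coh
  exists_meet : ∀ x y, coh x y → ∃ m, coh x m ∧ IsGLB {x, y} m
  exists_join : ∀ x y, coh x y → ∃ j, coh x j ∧ IsLUB {x, y} j
  /-- `x ∧ (y ∨ z) = (x ∧ y) ∨ (x ∧ z)` for coherent `x, y, z` -/
  distrib : ∀ x y z, coh x y → coh x z → ∀ j, IsLUB {y, z} j → ∀ a b m,
    IsGLB {x, y} a → IsGLB {x, z} b → IsGLB {x, j} m → IsLUB {a, b} m

/-- Bistable coherence of directed sets. -/
def SetCoh {D : Type u} [PartialOrder D] (coh : D → D → Prop) (X Y : Set D) : Prop :=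
  ∀ x ∈ X, ∀ y ∈ Y, ∃ x' ∈ X, ∃ y' ∈ Y, x ≤ x' ∧ y ≤ y' ∧ coh x' y'

/-- A bistable bicpo: a bistable biorder which is a cpo (every directed set has a least upper
bound) such that `X ↕ Y` implies `⊔X ↕ ⊔Y` and
`⊔X ∧ ⊔Y = ⊔ {x ∧ y | x ∈ X, y ∈ Y, x ↕ y}`. -/
structure IsBistableBicpo (D : Type u) [PartialOrder D] (coh : D → D → Prop) : Prop
    extends IsBistableBiorder D coh where
  exists_lub : ∀ X : Set D, X.Nonempty → DirectedOn (· ≤ ·) X → ∃ x, IsLUB X x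
  coh_lub : ∀ X Y : Set D, X.Nonempty → DirectedOn (· ≤ ·) X → Y.Nonempty →
    DirectedOn (· ≤ ·) Y → SetCoh coh X Y → ∀ x y, IsLUB X x → IsLUB Y y → coh x y
  meet_lub : ∀ X Y : Set D, X.Nonempty → DirectedOn (· ≤ ·) X → Y.Nonempty →
    DirectedOn (· ≤ ·) Y → SetCoh coh X Y → ∀ x y m, IsLUB X x → IsLUB Y y →
      IsGLB {x, y} m → IsLUB {w | ∃ a ∈ X, ∃ b ∈ Y, coh a b ∧ IsGLB {a, b} w} m

/-- A function is bistable if it preserves coherence, and meets and joins of coherent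
elements. -/
def IsBistable {D E : Type u} [PartialOrder D] [PartialOrder E] (cohD : D → D → Prop)
    (cohE : E → E → Prop) (f : D → E) : Prop :=
  ∀ x y, cohD x y → cohE (f x) (f y) ∧
    (∀ m, IsGLB {x, y} m → IsGLB {f x, f y} (f m)) ∧
    (∀ j, IsLUB {x, y} j → IsLUB {f x, f y} (f j))

/-- The objects of the category `BBC`: bistable bicpos. -/
structure BBC : Type (u + 1) where
  carrier : Type u
  [order : PartialOrder carrier]
  coh : carrier → carrier → Prop
  isBicpo : IsBistableBicpo carrier coh

attribute [instance] BBC.order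

/-- The morphisms of `BBC`: continuous and bistable functions. -/
@[ext]
structure BBC.Hom (D E : BBC.{u}) : Type u where
  toFun : D.carrier → E.carrier
  continuous : ScottContinuous toFun
  bistable : IsBistable D.coh E.coh toFun

instance : Category.{u} BBC.{u} where
  Hom := BBC.Hom
  id D := ⟨id, ScottContinuous.id, fun _ _ h => ⟨h, fun _ hm => hm, fun _ hj => hj⟩⟩
  comp {D E F} f g :=
    { toFun := g.toFun ∘ f.toFun
      continuous := ScottContinuous.comp f.continuous g.continuous
      bistable := fun x y h =>
        ⟨(g.bistable _ _ (f.bistable x y h).1).1,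
          fun m hm => (g.bistable _ _ (f.bistable x y h).1).2.1 _ ((f.bistable x y h).2.1 m hm),
          fun j hj =>
            (g.bistable _ _ (f.bistable x y h).1).2.2 _ ((f.bistable x y h).2.2 j hj)⟩ }

/-! ### Sequential data structures -/

/-- Player and Opponent. -/
inductive Polarity : Type
  | P
  | O

/-- Exchange Player and Opponent. -/
def Polarity.swap : Polarity → Polarity
  | .P => .O
  | .O => .P

/-- Finite alternating sequences without repetition of moves in which no prefix has more
Player than Opponent moves, that is, which start with an Opponent move unless empty. -/
def IsLegal {M : Type u} (label : M → Polarity) (s : List M) : Prop :=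
  s.IsChain (fun a b => label a ≠ label b) ∧ s.Nodup ∧ ∀ m ∈ s.head?, label m = .O

/-- A sequential data structure, presented as a game: moves, their labels, and a non-empty
prefix-closed set of plays. -/
structure Game : Type (u + 1) where
  Move : Type u
  label : Move → Polarity
  plays : Set (List Move)
  legal : ∀ s ∈ plays, IsLegal label s
  nil_mem : [] ∈ plays
  prefix_closed : ∀ s t, s <+: t → t ∈ plays → s ∈ plays

/-- `s ⊑ᴱ t`: `s` is an even-length prefix of `t`, or equal to `t`. -/
def EvenPrefix {M : Type u} (s t : List M) : Prop :=
  (s <+: t ∧ Even s.length) ∨ s = t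

/-- `w = s ⊓ t` is the longest common prefix of `s` and `t`. -/
def IsLongestCommonPrefix {M : Type u} (w s t : List M) : Prop :=
  w <+: s ∧ w <+: t ∧ ∀ v, v <+: s → v <+: t → v <+: w

/-- A set of plays is a sequential algorithm (Player strategy) if it is non-empty,
even-prefix-closed and even-branching. -/
structure IsStrategy (A : Game.{u}) (σ : Set (List A.Move)) : Prop where
  subset_plays : σ ⊆ A.plays
  nonempty : σ.Nonempty
  even_prefix_closed : ∀ s t, EvenPrefix s t → t ∈ σ → s ∈ σ
  even_branching : ∀ s ∈ σ, ∀ t ∈ σ, ∀ w, IsLongestCommonPrefix w s t →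
    EvenPrefix w s ∧ EvenPrefix w t

/-- The set `strat(A)` of sequential algorithms over `A`. -/
@[ext]
structure Strat (A : Game.{u}) : Type u where
  plays : Set (List A.Move)
  isStrategy : IsStrategy A plays

/-- The extensional order on plays. -/
def PlayLE {M : Type u} (s t : List M) : Prop :=
  (Even s.length ∧ s <+: t) ∨ (Odd t.length ∧ t <+: s)

theorem PlayLE.refl {M : Type u} (s : List M) : PlayLE s s := by
  rcases Nat.even_or_odd s.length with h | h
  · exact Or.inl ⟨h, List.prefix_rfl⟩
  · exact Or.inr ⟨h, List.prefix_rfl⟩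

theorem PlayLE.trans {M : Type u} {s t r : List M} (h : PlayLE s t) (k : PlayLE t r) :
    PlayLE s r := by
  rcases h with ⟨hs, h⟩ | ⟨ht, h⟩ <;> rcases k with ⟨ht', k⟩ | ⟨hr, k⟩
  · exact Or.inl ⟨hs, h.trans k⟩
  · rcases List.prefix_or_prefix_of_prefix h k with h' | h'
    · exact Or.inl ⟨hs, h'⟩
    · exact Or.inr ⟨hr, h'⟩
  · exact absurd ht' (Nat.not_even_iff_odd.mpr ht)
  · exact Or.inr ⟨hr, k.trans h⟩

theorem IsStrategy.nil_mem {A : Game.{u}} {σ : Set (List A.Move)} (h : IsStrategy A σ) :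
    [] ∈ σ := by
  obtain ⟨s, hs⟩ := h.nonempty
  exact h.even_prefix_closed _ _ (Or.inl ⟨List.nil_prefix, by simp⟩) hs

/-- A subset of a strategy is a strategy as soon as it is non-empty and even-prefix-closed. -/
theorem IsStrategy.mono {A : Game.{u}} {σ τ : Set (List A.Move)} (h : IsStrategy A τ)
    (hst : σ ⊆ τ) (h0 : σ.Nonempty) (h1 : ∀ s t, EvenPrefix s t → t ∈ σ → s ∈ σ) :
    IsStrategy A σ :=
  ⟨hst.trans h.subset_plays, h0, h1,
    fun s hs t ht w hw => h.even_branching s (hst hs) t (hst ht) w hw⟩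

theorem strat_subset_of_le_of_le {A : Game.{u}} {σ τ : Strat A}
    (h : ∀ s ∈ σ.plays, ∃ t ∈ τ.plays, PlayLE s t)
    (k : ∀ s ∈ τ.plays, ∃ t ∈ σ.plays, PlayLE s t) : σ.plays ⊆ τ.plays := by
  intro s hs
  obtain ⟨t, ht, ⟨he, hp⟩ | ⟨ho, hp⟩⟩ := h s hs
  · exact τ.isStrategy.even_prefix_closed s t (Or.inl ⟨hp, he⟩) ht
  · obtain ⟨r, hr, ⟨he, -⟩ | ⟨ho', hp'⟩⟩ := k t ht
    · exact absurd he (Nat.not_even_iff_odd.mpr ho)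
    · have hrs := (σ.isStrategy.even_branching r hr s hs r
        ⟨List.prefix_rfl, hp'.trans hp, fun v hv _ => hv⟩).2
      rcases hrs with ⟨-, he⟩ | rfl
      · exact absurd he (Nat.not_even_iff_odd.mpr ho')
      · have : r = t := hp'.eq_of_length_le hp.length_le
        exact this ▸ ht

/-- The extensional order on strategies. -/
instance (A : Game.{u}) : PartialOrder (Strat A) where
  le σ τ := ∀ s ∈ σ.plays, ∃ t ∈ τ.plays, PlayLE s t
  le_refl σ s hs := ⟨s, hs, PlayLE.refl s⟩
  le_trans σ τ ρ h k s hs := by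
    obtain ⟨t, ht, hst⟩ := h s hs
    obtain ⟨r, hr, htr⟩ := k t ht
    exact ⟨r, hr, hst.trans htr⟩
  le_antisymm σ τ h k :=
    Strat.ext (Set.Subset.antisymm (strat_subset_of_le_of_le h k) (strat_subset_of_le_of_le k h))

namespace Strat

variable {A : Game.{u}}

/-- The strategy `E(σ)` of even-length sequences in `σ`. -/
def evenPart (σ : Strat A) : Strat A where
  plays := {s ∈ σ.plays | Even s.length}
  isStrategy := σ.isStrategy.mono (fun _ h => h.1) ⟨[], σ.isStrategy.nil_mem, by simp⟩ (by
    rintro s t hst ⟨ht, he⟩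
    refine ⟨σ.isStrategy.even_prefix_closed s t hst ht, ?_⟩
    rcases hst with ⟨-, h⟩ | rfl
    exacts [h, he])

/-- Bistable coherence of strategies. -/
def Coh (σ τ : Strat A) : Prop := σ.evenPart = τ.evenPart

/-- The intersection of two strategies. -/
def inter (σ τ : Strat A) : Strat A where
  plays := σ.plays ∩ τ.plays
  isStrategy := σ.isStrategy.mono Set.inter_subset_left
    ⟨[], σ.isStrategy.nil_mem, τ.isStrategy.nil_mem⟩
    (fun s t hst h => ⟨σ.isStrategy.even_prefix_closed s t hst h.1,
      τ.isStrategy.even_prefix_closed s t hst h.2⟩)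

/-- Inclusion of strategies. -/
def Incl (σ τ : Strat A) : Prop := σ.plays ⊆ τ.plays

/-- Compatibility of strategies: boundedness with respect to inclusion. -/
def Compat (σ τ : Strat A) : Prop := ∃ ρ : Strat A, σ.Incl ρ ∧ τ.Incl ρ

/-- `σ` is the least upper bound of `S` with respect to inclusion. -/
def IsInclLUB (S : Set (Strat A)) (σ : Strat A) : Prop :=
  (∀ τ ∈ S, τ.Incl σ) ∧ ∀ ρ : Strat A, (∀ τ ∈ S, τ.Incl ρ) → σ.Incl ρ

end Strat

/-! ### The function-space `A ⇒ B = !A ⊸ B` -/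

/-- Restriction of a sequence over a disjoint union to the left component. -/
def restrictLeft {M N : Type u} (s : List (M ⊕ N)) : List M := s.filterMap Sum.getLeft?

/-- Restriction of a sequence over a disjoint union to the right component. -/
def restrictRight {M N : Type u} (s : List (M ⊕ N)) : List N := s.filterMap Sum.getRight?

theorem IsLegal.of_prefix {M : Type u} {label : M → Polarity} {s t : List M} (h : s <+: t)
    (ht : IsLegal label t) : IsLegal label s := by
  refine ⟨ht.1.prefix h, ht.2.1.sublist h.sublist, fun m hm => ht.2.2 m ?_⟩
  obtain ⟨r, rfl⟩ := h
  cases s with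
  | nil => simp at hm
  | cons a s => simpa using hm

/-- The affine function-space `A ⊸ B`. -/
def lolli (A B : Game.{u}) : Game.{u} where
  Move := A.Move ⊕ B.Move
  label := Sum.elim (fun a => (A.label a).swap) B.label
  plays := {s | IsLegal (Sum.elim (fun a => (A.label a).swap) B.label) s ∧
    restrictLeft s ∈ A.plays ∧ restrictRight s ∈ B.plays}
  legal _ h := h.1
  nil_mem := ⟨⟨by simp, by simp, by simp⟩, A.nil_mem, B.nil_mem⟩
  prefix_closed s t h ht := ⟨ht.1.of_prefix h,
    A.prefix_closed _ _ (h.filterMap _) ht.2.1, B.prefix_closed _ _ (h.filterMap _) ht.2.2⟩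

/-- The moves of `!A`: the non-empty plays of `A`. -/
abbrev BangMove (A : Game.{u}) : Type u := {p : List A.Move // p ∈ A.plays ∧ p ≠ []}

/-- The label of a non-empty play is the label of its last move. -/
def bangLabel (A : Game.{u}) (p : BangMove A) : Polarity := A.label (p.1.getLast p.2.2)

/-- `|s|ᴱ`: the empty play, together with the plays `p` such that `tp ⊑ᴱ s` for some `t`. -/
def bangSet {A : Game.{u}} (s : List (BangMove A)) : Set (List A.Move) :=
  {[]} ∪ {p | ∃ (t : List (BangMove A)) (m : BangMove A), m.1 = p ∧ EvenPrefix (t ++ [m]) s}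

theorem bangSet_nil {A : Game.{u}} : bangSet ([] : List (BangMove A)) = {[]} := by
  ext p
  simp [bangSet, EvenPrefix]

theorem isStrategy_singleton_nil (A : Game.{u}) : IsStrategy A {[]} where
  subset_plays := by simpa using A.nil_mem
  nonempty := ⟨[], rfl⟩
  even_prefix_closed := by
    rintro s t h rfl
    rcases h with ⟨h, -⟩ | h
    · simpa using h
    · exact h
  even_branching := by
    rintro s rfl t rfl w ⟨h, -, -⟩
    have : w = [] := by simpa using h
    exact ⟨Or.inr this, Or.inr this⟩

/-- The game `!A`: its plays are the legal sequences `s` of non-empty plays of `A` in which each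
Opponent move `q` is answered, if at all, by an extension of `q` by one move, and such that
`|t|ᴱ` is a strategy for every prefix `t` of `s`. -/
def bang (A : Game.{u}) : Game.{u} where
  Move := BangMove A
  label := bangLabel A
  plays := {s | IsLegal (bangLabel A) s ∧ (∀ t, t <+: s → IsStrategy A (bangSet t)) ∧
    ∀ (t : List (BangMove A)) (q r : BangMove A), Even t.length → t ++ [q, r] <+: s →
      ∃ b, r.1 = q.1 ++ [b]}
  legal _ h := h.1
  nil_mem := by
    refine ⟨⟨by simp, by simp, by simp⟩, fun t ht => ?_, fun t q r _ ht => ?_⟩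
    · obtain rfl : t = [] := by simpa using ht
      rw [bangSet_nil]
      exact isStrategy_singleton_nil A
    · simp at ht
  prefix_closed s t h ht := ⟨ht.1.of_prefix h, fun r hr => ht.2.1 r (hr.trans h),
    fun r q q' he hr => ht.2.2 r q q' he (hr.trans h)⟩

/-- The function-space `A ⇒ B`. -/
def fn (A B : Game.{u}) : Game.{u} := lolli (bang A) B

/-- `|s ↾ !A|ᴱ` for a sequence `s` of moves of `A ⇒ B`. -/
def argPlays {A B : Game.{u}} (s : List (fn A B).Move) : Set (List A.Move) :=
  bangSet (A := A) (restrictLeft (M := BangMove A) (N := B.Move) s)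

/-- `s ↾ B` for a sequence `s` of moves of `A ⇒ B`. -/
def resPlay {A B : Game.{u}} (s : List (fn A B).Move) : List B.Move :=
  restrictRight (M := BangMove A) (N := B.Move) s

/-- The application `σ · τ = {s ↾ B | s ∈ σ, |s ↾ !A|ᴱ ⊆ τ}` of `σ : A ⇒ B` to `τ : A`, as a set
of plays of `B`. -/
def app {A B : Game.{u}} (σ : Strat (fn A B)) (τ : Strat A) : Set (List B.Move) :=
  {t | ∃ s ∈ σ.plays, argPlays s ⊆ τ.plays ∧ resPlay s = t}

/-- The sequential algorithm `σ` on `A ⇒ B` realizes (computes) the function `f`. -/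
def Realizes {A B : Game.{u}} (σ : Strat (fn A B)) (f : Strat A → Strat B) : Prop :=
  ∀ τ : Strat A, (f τ).plays = app σ τ

/-- Observably sequential functions: those realized by a sequential algorithm. -/
def ObservablySequential {A B : Game.{u}} (f : Strat A → Strat B) : Prop :=
  ∃ σ : Strat (fn A B), Realizes σ f

/-! ### Stability, traces, sequentialization -/

/-- Stability: continuity with respect to inclusion, and conditional multiplicativity. -/
structure IsStable {A B : Game.{u}} (f : Strat A → Strat B) : Prop where
  continuous : ∀ S : Set (Strat A), S.Nonempty → DirectedOn Strat.Incl S → ∀ σ : Strat A,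
    Strat.IsInclLUB S σ → Strat.IsInclLUB (f '' S) (f σ)
  multiplicative : ∀ σ σ' τ : Strat A, σ.Incl τ → σ'.Incl τ →
    f (σ.inter σ') = (f σ).inter (f σ')

/-- The trace of a function. -/
def tr {A B : Game.{u}} (f : Strat A → Strat B) : Set (Strat A × List B.Move) :=
  {x | x.2 ∈ (f x.1).plays ∧
    ∀ τ : Strat A, x.1.Compat τ → x.2 ∈ (f τ).plays → x.1.Incl τ}

/-- The sequentialization of the trace of `f`: the plays `s` of `A ⇒ B` such that
`(|t ↾ !A|ᴱ, t ↾ B) ∈ tr(f)` for all `t ⊑ᴱ s`. -/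
def seqTrace {A B : Game.{u}} (f : Strat A → Strat B) : Set (List (fn A B).Move) :=
  {s | s ∈ (fn A B).plays ∧ ∀ t, EvenPrefix t s →
    ∃ τ : Strat A, τ.plays = argPlays t ∧ (τ, resPlay t) ∈ tr f}

/-- `strat(A)` as an object of `BBC`, given that it is a bistable bicpo. -/
def stratBBC (A : Game.{u}) (h : IsBistableBicpo (Strat A) Strat.Coh) : BBC.{u} where
  carrier := Strat A
  coh := Strat.Coh
  isBicpo := h

/-- The function `strat(A) → strat(B)` underlying a morphism of `BBC`. -/
def homFun {A B : Game.{u}} {hA : IsBistableBicpo (Strat A) Strat.Coh}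
    {hB : IsBistableBicpo (Strat B) Strat.Coh} (f : stratBBC A hA ⟶ stratBBC B hB) :
    Strat A → Strat B :=
  BBC.Hom.toFun (D := stratBBC A hA) (E := stratBBC B hB) f

end Bistable

open Bistable

/-! In a strategy an even-length play records an answer of Player, and an odd-length play, which is
maximal, records that Player escapes at that point. Going up in `≤` means answering more, or
escaping at an earlier position. Coherent strategies give the same answers and differ only in where
they escape; within a class, `≤` is inclusion, meet is intersection and join is union. The least
upper bound of a directed set consists of the plays that are eventually present (`isLUB_lim`).

The bridge from `≤` to inclusion is the cover. If `ρ ⊆ τ`, let `ρ.cover τ` be `ρ` escaping wherever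
`τ` reacts and `ρ` does not. Then `ρ ≤ τ ≤ ρ.cover τ` with coherent end points, and such an interval
forces `f ρ ⊆ f τ` (`map_incl`). For `σ` and `σ'` inside a common strategy, the covers of `σ ∩ σ'`
by `σ` and by `σ'` are coherent and meet in `σ ∩ σ'`, so preservation of meets gives stability. With
continuity, every output then has a unique finite minimal cause in a given argument, which is the
trace token (`exists_mem_tr`).

Sequentiality comes from preservation of joins. A finite set of escapes is a join of single ones, so
an output that needs any of them needs only one (`mem_map_addCells`). Let a part `ρ` of the argument
be large enough for `t` but not for the token. Covering `ρ` makes `f` escape at `t ++ [a]`, and one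
escape already does this; it marks an Opponent position that must be explored next. Adding the
answers one after another yields the last query (`exists_last_query`); two distinct last queries are
excluded by joins and minimality again (`query_unique`).

Peeling off last queries and last inputs by induction shows that every token comes from a play of
the sequentialized trace (`exists_mem_seqTrace`), so `seqTrace f` computes `f`. Conversely, two
plays of an algorithm whose arguments have a common bound can branch only where Opponent moves in
the result (`eq_or_resPlay_branch`). Hence application preserves coherence, meets and joins, and an
algorithm equals the sequentialized trace of its function. Algorithms therefore correspond
bijectively to morphisms of `BBC`, and the category structure is transported along this bijection.
-/

namespace Bistable

/-! ### Prefixes -/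

theorem eq_or_exists_common_prefix {M : Type u} (s t : List M) :
    s = t ∨ ∃ w r r', s = w ++ r ∧ t = w ++ r' ∧ r.head? ≠ r'.head? := by
  induction s generalizing t with
  | nil =>
    cases t with
    | nil => exact Or.inl rfl
    | cons b t => exact Or.inr ⟨[], [], b :: t, rfl, rfl, by simp⟩
  | cons a s ih =>
    cases t with
    | nil => exact Or.inr ⟨[], a :: s, [], rfl, rfl, by simp⟩
    | cons b t =>
      by_cases hab : a = b
      · subst hab
        rcases ih t with rfl | ⟨w, r, r', rfl, rfl, h⟩
        · exact Or.inl rfl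
        · exact Or.inr ⟨a :: w, r, r', rfl, rfl, h⟩
      · exact Or.inr ⟨[], a :: s, b :: t, rfl, rfl, by simpa using hab⟩

theorem isLongestCommonPrefix_append {M : Type u} {w r r' : List M} (h : r.head? ≠ r'.head?) :
    IsLongestCommonPrefix w (w ++ r) (w ++ r') := by
  refine ⟨List.prefix_append _ _, List.prefix_append _ _, fun v hv hv' => ?_⟩
  rcases List.prefix_or_prefix_of_prefix hv (List.prefix_append w r) with hw | ⟨v, rfl⟩
  · exact hw
  · rw [List.prefix_append_right_inj] at hv hv'
    cases v with
    | nil => simp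
    | cons c v =>
      obtain ⟨_, rfl⟩ := hv
      obtain ⟨_, rfl⟩ := hv'
      simp at h

theorem exists_concat_prefix {M : Type u} {w t : List M} (h : w <+: t) (hne : w ≠ t) :
    ∃ x, w ++ [x] <+: t := by
  obtain ⟨r, rfl⟩ := h
  cases r with
  | nil => simp at hne
  | cons x r => exact ⟨x, r, by simp⟩

theorem eq_of_concat_prefix {M : Type u} {w t : List M} {x y : M} (hx : w ++ [x] <+: t)
    (hy : w ++ [y] <+: t) : x = y := by
  have := List.prefix_of_prefix_length_le hx hy (by simp)
  simpa using this

theorem EvenPrefix.isPrefix {M : Type u} {s t : List M} (h : EvenPrefix s t) : s <+: t := by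
  rcases h with ⟨h, -⟩ | rfl
  exacts [h, List.prefix_rfl]

theorem EvenPrefix.trans {M : Type u} {s t r : List M} (h : EvenPrefix s t)
    (k : EvenPrefix t r) : EvenPrefix s r := by
  rcases h with ⟨h, he⟩ | rfl
  · exact Or.inl ⟨h.trans k.isPrefix, he⟩
  · exact k

theorem odd_prefix_of_prefix_concat {M : Type u} {u t : List M} {a : M} (h : u <+: t ++ [a])
    (hne : ¬ u <+: t) : u = t ++ [a] :=
  (List.prefix_concat_iff.1 h).resolve_right hne

theorem even_length_concat {M : Type u} {s : List M} {a : M} :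
    Even (s ++ [a]).length ↔ Odd s.length := by
  simp [Nat.even_add_one]

theorem odd_length_concat {M : Type u} {s : List M} {a : M} :
    Odd (s ++ [a]).length ↔ Even s.length := by
  rw [← Nat.not_even_iff_odd, even_length_concat, Nat.not_odd_iff_even]

/-- Every list of odd length ends with a move preceded by a list of even length. -/
theorem exists_eq_concat_of_odd {M : Type u} {s : List M} (h : Odd s.length) :
    ∃ p a, s = p ++ [a] ∧ Even p.length := by
  rcases List.eq_nil_or_concat' s with rfl | ⟨p, a, rfl⟩
  · simp at h
  · exact ⟨p, a, rfl, odd_length_concat.1 h⟩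

/-! ### Strategies as deterministic sets of plays -/

namespace IsStrategy

variable {A : Game.{u}} {σ : Set (List A.Move)}

theorem mem_of_even_prefix (h : IsStrategy A σ) {s t : List A.Move} (ht : t ∈ σ) (hst : s <+: t)
    (hs : Even s.length) : s ∈ σ :=
  h.even_prefix_closed s t (Or.inl ⟨hst, hs⟩) ht

/-- Even branching read as determinism: two plays of a strategy cannot part at an odd-length
position, where Player is to react. -/
theorem concat_prefix (h : IsStrategy A σ) {s t w : List A.Move} {x : A.Move} (hs : s ∈ σ)
    (ht : t ∈ σ) (hw : Odd w.length) (hws : w ++ [x] <+: s) (hwt : w <+: t) :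
    w ++ [x] <+: t := by
  rcases eq_or_exists_common_prefix s t with rfl | ⟨v, r, r', rfl, rfl, hne⟩
  · exact hws
  · have hv := isLongestCommonPrefix_append (w := v) hne
    have hwv := hv.2.2 w ((List.prefix_append _ _).trans hws) hwt
    have hwne : w ≠ v := by
      rintro rfl
      rcases (h.even_branching _ hs _ ht _ hv).1 with ⟨-, he⟩ | he
      · exact Nat.not_even_iff_odd.2 hw he
      · have := hws.length_le
        rw [← he] at this
        simp at this
    obtain ⟨y, hy⟩ := exists_concat_prefix hwv hwne
    obtain rfl := eq_of_concat_prefix hws (hy.trans (List.prefix_append _ _))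
    exact hy.trans (List.prefix_append _ _)

/-- The odd-length plays of a strategy are maximal. -/
theorem eq_of_odd_prefix (h : IsStrategy A σ) {s t : List A.Move} (hs : s ∈ σ) (ht : t ∈ σ)
    (ho : Odd s.length) (hst : s <+: t) : s = t := by
  by_contra hne
  obtain ⟨x, hx⟩ := exists_concat_prefix hst hne
  have := (h.concat_prefix ht hs ho hx List.prefix_rfl).length_le
  simp at this

theorem notMem_of_concat_mem (h : IsStrategy A σ) {w : List A.Move} {x : A.Move}
    (hw : Odd w.length) (hx : w ++ [x] ∈ σ) : w ∉ σ := fun hwσ => by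
  simpa using h.eq_of_odd_prefix hwσ hx hw (List.prefix_append _ _)

theorem concat_inj (h : IsStrategy A σ) {w : List A.Move} {x y : A.Move} (hw : Odd w.length)
    (hx : w ++ [x] ∈ σ) (hy : w ++ [y] ∈ σ) : x = y := by
  simpa using (h.concat_prefix hx hy hw List.prefix_rfl (List.prefix_append _ _)).eq_of_length
    (by simp)

/-- Even branching can fail only at an odd-length common prefix, so it suffices that an escape
excludes an answer and that answers are unique. The unions, limits, applications and traces below
are shown to be strategies in this way. -/
theorem of_det (hP : σ ⊆ A.plays) (h0 : [] ∈ σ)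
    (h1 : ∀ s t, s <+: t → Even s.length → t ∈ σ → s ∈ σ)
    (h2 : ∀ w x, Odd w.length → w ++ [x] ∈ σ → w ∉ σ)
    (h3 : ∀ w x y, Odd w.length → w ++ [x] ∈ σ → w ++ [y] ∈ σ → x = y) : IsStrategy A σ where
  subset_plays := hP
  nonempty := ⟨[], h0⟩
  even_prefix_closed := by
    rintro s t (⟨h, he⟩ | rfl) ht
    exacts [h1 s t h he ht, ht]
  even_branching := by
    intro s hs t ht w ⟨hws, hwt, hw⟩
    rcases Nat.even_or_odd w.length with he | ho
    · exact ⟨Or.inl ⟨hws, he⟩, Or.inl ⟨hwt, he⟩⟩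
    · have key : ∀ s ∈ σ, ∀ x, w ++ [x] <+: s → w ++ [x] ∈ σ := fun s hs x hx =>
        h1 _ _ hx (even_length_concat.2 ho) hs
      by_cases hs' : w = s
      · by_cases ht' : w = t
        · exact ⟨Or.inr hs', Or.inr ht'⟩
        · obtain ⟨x, hx⟩ := exists_concat_prefix hwt ht'
          exact absurd (hs' ▸ hs) (h2 w x ho (key t ht x hx))
      · obtain ⟨x, hx⟩ := exists_concat_prefix hws hs'
        by_cases ht' : w = t
        · exact absurd (ht' ▸ ht) (h2 w x ho (key s hs x hx))
        · obtain ⟨y, hy⟩ := exists_concat_prefix hwt ht'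
          obtain rfl := h3 w x y ho (key s hs x hx) (key t ht y hy)
          have := (hw _ hx hy).length_le
          simp at this

end IsStrategy

/-! ### Inclusion, the extensional order and coherence classes -/

namespace Strat

variable {A : Game.{u}} {σ τ ρ : Strat A}

theorem mem_of_even_prefix {s t : List A.Move} (ht : t ∈ σ.plays) (hst : s <+: t)
    (hs : Even s.length) : s ∈ σ.plays :=
  σ.isStrategy.mem_of_even_prefix ht hst hs

theorem eq_of_odd_prefix {s t : List A.Move} (hs : s ∈ σ.plays) (ht : t ∈ σ.plays)
    (ho : Odd s.length) (hst : s <+: t) : s = t :=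
  σ.isStrategy.eq_of_odd_prefix hs ht ho hst

theorem Incl.le (h : σ.Incl τ) : σ ≤ τ := fun s hs => ⟨s, h hs, PlayLE.refl s⟩

theorem Incl.trans (h : σ.Incl τ) (k : τ.Incl ρ) : σ.Incl ρ := Set.Subset.trans h k

theorem Incl.antisymm (h : σ.Incl τ) (k : τ.Incl σ) : σ = τ := Strat.ext (Set.Subset.antisymm h k)

theorem inter_incl_left : (σ.inter τ).Incl σ := Set.inter_subset_left

theorem inter_incl_right : (σ.inter τ).Incl τ := Set.inter_subset_right

theorem evenPart_incl : σ.evenPart.Incl σ := fun _ h => h.1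

theorem Compat.symm (h : σ.Compat τ) : τ.Compat σ := h.imp fun _ h => h.symm

theorem Compat.of_incl_right (h : σ.Compat τ) (k : ρ.Incl τ) : σ.Compat ρ :=
  h.imp fun _ h => ⟨h.1, k.trans h.2⟩

theorem Incl.compat (h : σ.Incl τ) : σ.Compat τ := ⟨τ, h, Set.Subset.rfl⟩

/-- Intervals for the extensional order are convex for membership. -/
theorem mem_of_le_of_le (h : σ ≤ τ) (k : τ ≤ ρ) {s : List A.Move} (hs : s ∈ σ.plays)
    (hs' : s ∈ ρ.plays) : s ∈ τ.plays := by
  obtain ⟨t, ht, ⟨he, hp⟩ | ⟨ho, hp⟩⟩ := h s hs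
  · exact mem_of_even_prefix ht hp he
  · obtain ⟨r, hr, ⟨he, -⟩ | ⟨ho', hp'⟩⟩ := k t ht
    · exact absurd he (Nat.not_even_iff_odd.2 ho)
    · obtain rfl := eq_of_odd_prefix hr hs' ho' (hp'.trans hp)
      rwa [← hp.eq_of_length_le hp'.length_le]

theorem Coh.symm (h : σ.Coh τ) : τ.Coh σ := Eq.symm h

theorem Coh.trans (h : σ.Coh τ) (k : τ.Coh ρ) : σ.Coh ρ := Eq.trans h k

theorem coh_of_forall (h : ∀ s, Even s.length → (s ∈ σ.plays ↔ s ∈ τ.plays)) : σ.Coh τ :=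
  Strat.ext (Set.ext fun s => ⟨fun hs => ⟨(h s hs.2).1 hs.1, hs.2⟩,
    fun hs => ⟨(h s hs.2).2 hs.1, hs.2⟩⟩)

theorem Coh.mem (h : σ.Coh τ) {s : List A.Move} (hs : s ∈ σ.plays) (he : Even s.length) :
    s ∈ τ.plays := by
  have : s ∈ σ.evenPart.plays := ⟨hs, he⟩
  rw [show σ.evenPart = τ.evenPart from h] at this
  exact this.1

theorem coh_evenPart : σ.Coh σ.evenPart :=
  coh_of_forall fun _ hs => ⟨fun h => ⟨h, hs⟩, fun h => h.1⟩

/-- A proper extension would contain an answer at `s`; answers are shared by coherent strategies,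
whereas `σ` escapes at `s`. -/
theorem Coh.eq_of_odd_prefix (h : σ.Coh τ) {s t : List A.Move} (hs : s ∈ σ.plays)
    (ht : t ∈ τ.plays) (ho : Odd s.length) (hst : s <+: t) : s = t := by
  by_contra hne
  obtain ⟨x, hx⟩ := exists_concat_prefix hst hne
  have he := even_length_concat (a := x) |>.2 ho
  exact σ.isStrategy.notMem_of_concat_mem ho
    (h.symm.mem (mem_of_even_prefix ht hx he) he) hs

theorem Coh.incl_of_le (h : σ.Coh τ) (hle : σ ≤ τ) : σ.Incl τ := by
  intro s hs
  obtain ⟨t, ht, ⟨he, hp⟩ | ⟨ho, hp⟩⟩ := hle s hs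
  · exact mem_of_even_prefix ht hp he
  · rwa [← h.symm.eq_of_odd_prefix ht hs ho hp]

/-- Turns monotonicity for `≤` into monotonicity for inclusion: the coherent ends are ordered by
inclusion, and membership is convex. -/
theorem Coh.incl_of_le_of_le (h : σ.Coh ρ) (k : σ ≤ τ) (l : τ ≤ ρ) : σ.Incl τ :=
  fun _ hs => mem_of_le_of_le k l hs (h.incl_of_le (k.trans l) hs)

theorem Coh.isGLB_inter (h : σ.Coh τ) : IsGLB {σ, τ} (σ.inter τ) := by
  constructor
  · rintro _ (rfl | rfl)
    exacts [inter_incl_left.le, inter_incl_right.le]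
  · intro ρ hρ s hs
    obtain ⟨t, ht, ⟨he, hp⟩ | ⟨ho, hp⟩⟩ := hρ (Or.inl rfl) s hs
    · have := mem_of_even_prefix ht hp he
      exact ⟨s, ⟨this, h.mem this he⟩, PlayLE.refl s⟩
    · obtain ⟨t', ht', ⟨he, hp'⟩ | ⟨ho', hp'⟩⟩ := hρ (Or.inr rfl) s hs
      · have := mem_of_even_prefix ht' hp' he
        exact ⟨s, ⟨h.symm.mem this he, this⟩, PlayLE.refl s⟩
      · have : t = t' := by
          rcases List.prefix_or_prefix_of_prefix hp hp' with k | k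
          · exact h.eq_of_odd_prefix ht ht' ho k
          · exact (h.symm.eq_of_odd_prefix ht' ht ho' k).symm
        subst this
        exact ⟨t, ⟨ht, ht'⟩, Or.inr ⟨ho, hp⟩⟩

/-- The union of coherent strategies. -/
def union (σ τ : Strat A) (h : σ.Coh τ) : Strat A where
  plays := σ.plays ∪ τ.plays
  isStrategy := by
    have hl : ∀ s ∈ σ.plays ∪ τ.plays, Even s.length → s ∈ σ.plays ∧ s ∈ τ.plays := by
      rintro s (hs | hs) he
      exacts [⟨hs, h.mem hs he⟩, ⟨h.symm.mem hs he, hs⟩]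
    refine .of_det (Set.union_subset σ.isStrategy.subset_plays τ.isStrategy.subset_plays)
      (Or.inl σ.isStrategy.nil_mem) ?_ ?_ ?_
    · rintro s t hst he (ht | ht)
      exacts [Or.inl (mem_of_even_prefix ht hst he), Or.inr (mem_of_even_prefix ht hst he)]
    · intro w x ho hx
      have := hl _ hx (even_length_concat.2 ho)
      rintro (hw | hw)
      exacts [σ.isStrategy.notMem_of_concat_mem ho this.1 hw,
        τ.isStrategy.notMem_of_concat_mem ho this.2 hw]
    · intro w x y ho hx hy
      exact σ.isStrategy.concat_inj ho (hl _ hx (even_length_concat.2 ho)).1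
        (hl _ hy (even_length_concat.2 ho)).1

theorem incl_union_left (h : σ.Coh τ) : σ.Incl (σ.union τ h) := Set.subset_union_left

theorem incl_union_right (h : σ.Coh τ) : τ.Incl (σ.union τ h) := Set.subset_union_right

theorem Coh.compat (h : σ.Coh τ) : σ.Compat τ :=
  ⟨σ.union τ h, incl_union_left h, incl_union_right h⟩

theorem Coh.isLUB_union (h : σ.Coh τ) : IsLUB {σ, τ} (σ.union τ h) := by
  constructor
  · rintro _ (rfl | rfl)
    exacts [(incl_union_left h).le, (incl_union_right h).le]
  · rintro ρ hρ s (hs | hs)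
    exacts [hρ (Or.inl rfl) s hs, hρ (Or.inr rfl) s hs]

theorem Coh.coh_inter (h : σ.Coh τ) : σ.Coh (σ.inter τ) :=
  coh_of_forall fun _ he => ⟨fun hs => ⟨hs, h.mem hs he⟩, fun hs => hs.1⟩

theorem Coh.coh_union (h : σ.Coh τ) : σ.Coh (σ.union τ h) :=
  coh_of_forall fun _ he => ⟨Or.inl, fun hs => hs.elim id fun hs => h.symm.mem hs he⟩

/-! ### Least upper bounds of directed sets -/

/-- The plays which are eventually in the elements of a directed set form a strategy. -/
def lim (X : Set (Strat A)) (h0 : X.Nonempty) (hX : DirectedOn (· ≤ ·) X) : Strat A where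
  plays := {s | ∃ σ ∈ X, ∀ τ ∈ X, σ ≤ τ → s ∈ τ.plays}
  isStrategy := by
    have hc : ∀ s t : List A.Move, (∃ σ ∈ X, ∀ τ ∈ X, σ ≤ τ → s ∈ τ.plays) →
        (∃ σ ∈ X, ∀ τ ∈ X, σ ≤ τ → t ∈ τ.plays) → ∃ τ ∈ X, s ∈ τ.plays ∧ t ∈ τ.plays := by
      rintro s t ⟨σ, hσ, hs⟩ ⟨τ, hτ, ht⟩
      obtain ⟨ρ, hρ, h, k⟩ := hX σ hσ τ hτ
      exact ⟨ρ, hρ, hs ρ hρ h, ht ρ hρ k⟩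
    refine .of_det ?_ ?_ ?_ ?_ ?_
    · rintro s ⟨σ, hσ, hs⟩
      exact σ.isStrategy.subset_plays (hs σ hσ le_rfl)
    · obtain ⟨σ, hσ⟩ := h0
      exact ⟨σ, hσ, fun τ _ _ => τ.isStrategy.nil_mem⟩
    · rintro s t hst he ⟨σ, hσ, ht⟩
      exact ⟨σ, hσ, fun τ hτ h => mem_of_even_prefix (ht τ hτ h) hst he⟩
    · intro w x ho hx hw
      obtain ⟨τ, -, h, k⟩ := hc _ _ hx hw
      exact τ.isStrategy.notMem_of_concat_mem ho h k
    · intro w x y ho hx hy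
      obtain ⟨τ, -, h, k⟩ := hc _ _ hx hy
      exact τ.isStrategy.concat_inj ho h k

/-- A play that disappears higher up in `X` is overtaken by an escape at one of its prefixes.
Overtaking an escape strictly shortens it, so some escape eventually persists. -/
theorem isLUB_lim {X : Set (Strat A)} (h0 : X.Nonempty) (hX : DirectedOn (· ≤ ·) X) :
    IsLUB X (lim X h0 hX) := by
  have hodd : ∀ n : ℕ, ∀ σ ∈ X, ∀ s ∈ σ.plays, Odd s.length → s.length ≤ n →
      ∃ t ∈ (lim X h0 hX).plays, Odd t.length ∧ t <+: s := by
    intro n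
    induction n with
    | zero =>
      intro σ _ s _ ho hn
      simp [Nat.le_zero.1 hn] at ho
    | succ n ih =>
      intro σ hσ s hs ho hn
      by_cases hall : ∀ τ ∈ X, σ ≤ τ → s ∈ τ.plays
      · exact ⟨s, ⟨σ, hσ, hall⟩, ho, List.prefix_rfl⟩
      · push Not at hall
        obtain ⟨τ, hτ, hle, hns⟩ := hall
        obtain ⟨t, ht, ⟨he, -⟩ | ⟨ho', hp⟩⟩ := hle s hs
        · exact absurd he (Nat.not_even_iff_odd.2 ho)
        · have hlt : t.length < s.length := by
            refine lt_of_le_of_ne hp.length_le fun he => hns ?_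
            rwa [← hp.eq_of_length he]
          obtain ⟨r, hr, hor, hrt⟩ := ih τ hτ t ht ho' (by omega)
          exact ⟨r, hr, hor, hrt.trans hp⟩
  constructor
  · intro σ hσ s hs
    rcases Nat.even_or_odd s.length with he | ho
    · by_cases hall : ∀ τ ∈ X, σ ≤ τ → s ∈ τ.plays
      · exact ⟨s, ⟨σ, hσ, hall⟩, PlayLE.refl s⟩
      · push Not at hall
        obtain ⟨τ, hτ, hle, hns⟩ := hall
        obtain ⟨t, ht, ⟨he, hp⟩ | ⟨ho', hp⟩⟩ := hle s hs
        · exact absurd (mem_of_even_prefix ht hp he) hns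
        · obtain ⟨r, hr, hor, hrt⟩ := hodd _ τ hτ t ht ho' le_rfl
          exact ⟨r, hr, Or.inr ⟨hor, hrt.trans hp⟩⟩
    · obtain ⟨r, hr, hor, hrt⟩ := hodd _ σ hσ s hs ho le_rfl
      exact ⟨r, hr, Or.inr ⟨hor, hrt⟩⟩
  · rintro ρ hρ s ⟨σ, hσ, hs⟩
    exact hρ hσ s (hs σ hσ le_rfl)

theorem mem_lub_iff {X : Set (Strat A)} (h0 : X.Nonempty) (hX : DirectedOn (· ≤ ·) X)
    (hσ : IsLUB X σ) {s : List A.Move} :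
    s ∈ σ.plays ↔ ∃ σ ∈ X, ∀ τ ∈ X, σ ≤ τ → s ∈ τ.plays := by
  rw [hσ.unique (isLUB_lim h0 hX)]
  rfl

/-- An answer that persists in `X` passes by coherence to cofinally many elements of `Y`; convexity
of membership fills in the elements between them. -/
theorem coh_lub {X Y : Set (Strat A)} (hX0 : X.Nonempty) (hX : DirectedOn (· ≤ ·) X)
    (hY0 : Y.Nonempty) (hY : DirectedOn (· ≤ ·) Y) (hXY : SetCoh Coh X Y) (hσ : IsLUB X σ)
    (hτ : IsLUB Y τ) : σ.Coh τ := by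
  have key : ∀ {X Y : Set (Strat A)} {σ τ : Strat A}, X.Nonempty → DirectedOn (· ≤ ·) X →
      Y.Nonempty → DirectedOn (· ≤ ·) Y → SetCoh Coh X Y → IsLUB X σ → IsLUB Y τ →
      ∀ s, Even s.length → s ∈ σ.plays → s ∈ τ.plays := by
    intro X Y σ τ hX0 hX hY0 hY hXY hσ hτ s he hs
    obtain ⟨x, hx, hsx⟩ := (mem_lub_iff hX0 hX hσ).1 hs
    obtain ⟨y, hy⟩ := hY0
    refine (mem_lub_iff ⟨y, hy⟩ hY hτ).2 ?_
    obtain ⟨x', hx', y', hy', hxx', -, hc⟩ := hXY x hx y hy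
    refine ⟨y', hy', fun z hz hyz => ?_⟩
    obtain ⟨x'', hx'', z', hz', hxx'', hzz', hc'⟩ := hXY x hx z hz
    exact mem_of_le_of_le hyz hzz' (hc.mem (hsx x' hx' hxx') he) (hc'.mem (hsx x'' hx'' hxx'') he)
  refine coh_of_forall fun s he => ⟨key hX0 hX hY0 hY hXY hσ hτ s he,
    key hY0 hY hX0 hX (fun y hy x hx => ?_) hτ hσ s he⟩
  obtain ⟨x', hx', y', hy', h, k, hc⟩ := hXY x hx y hy
  exact ⟨y', hy', x', hx', k, h, hc.symm⟩

variable (A) in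
theorem isBistableBicpo : IsBistableBicpo (Strat A) Coh where
  equiv := ⟨fun _ => rfl, Coh.symm, Coh.trans⟩
  exists_meet _ _ h := ⟨_, h.coh_inter, h.isGLB_inter⟩
  exists_join _ _ h := ⟨_, h.coh_union, h.isLUB_union⟩
  distrib x y z hxy hxz j hj a b m ha hb hm := by
    have hyz := hxy.symm.trans hxz
    obtain rfl := hj.unique hyz.isLUB_union
    obtain rfl := ha.unique hxy.isGLB_inter
    obtain rfl := hb.unique hxz.isGLB_inter
    obtain rfl := hm.unique (hxy.trans hyz.coh_union).isGLB_inter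
    have hab : (x.inter y).Coh (x.inter z) := hxy.coh_inter.symm.trans hxz.coh_inter
    rw [show x.inter (y.union z hyz) = (x.inter y).union (x.inter z) hab from
      Strat.ext (Set.inter_union_distrib_left _ _ _)]
    exact hab.isLUB_union
  exists_lub X h0 hX := ⟨_, isLUB_lim h0 hX⟩
  coh_lub X Y hX0 hX hY0 hY hXY _ _ hx hy := coh_lub hX0 hX hY0 hY hXY hx hy
  meet_lub X Y hX0 hX hY0 hY hXY x y m hx hy hm := by
    constructor
    · rintro w ⟨a, ha, b, hb, -, hw⟩
      refine hm.2 ?_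
      rintro _ (rfl | rfl)
      exacts [(hw.1 (Or.inl rfl)).trans (hx.1 ha), (hw.1 (Or.inr rfl)).trans (hy.1 hb)]
    · intro ρ hρ s hs
      rw [hm.unique (coh_lub hX0 hX hY0 hY hXY hx hy).isGLB_inter] at hs
      obtain ⟨a, ha, hsa⟩ := (mem_lub_iff hX0 hX hx).1 hs.1
      obtain ⟨b, hb, hsb⟩ := (mem_lub_iff hY0 hY hy).1 hs.2
      obtain ⟨a', ha', b', hb', haa', hbb', hc⟩ := hXY a ha b hb
      exact hρ ⟨a', ha', b', hb', hc, hc.isGLB_inter⟩ s ⟨hsa a' ha' haa', hsb b' hb' hbb'⟩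

end Strat

theorem even_concat_induction {M : Type u} {P : List M → Prop} (nil : P [])
    (concat : ∀ p a b, Even p.length → P p → P (p ++ [a, b])) :
    ∀ s : List M, Even s.length → P s := by
  have key : ∀ n : ℕ, ∀ s : List M, s.length = n → Even n → P s := by
    intro n
    induction n using Nat.strong_induction_on with
    | _ n ih =>
      intro s hs he
      rcases List.eq_nil_or_concat' s with rfl | ⟨s, b, rfl⟩
      · exact nil
      · rcases List.eq_nil_or_concat' s with rfl | ⟨p, a, rfl⟩
        · simp at hs
          simp [← hs] at he
        · simp at hs
          have hp : Even p.length := by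
            rw [← hs] at he
            simpa [Nat.even_add_one] using he
          simpa using concat p a b hp (ih p.length (by omega) p rfl hp)
  exact fun s hs => key _ s rfl hs

theorem finite_prefixes {M : Type u} (s : List M) : {t | t <+: s}.Finite :=
  (List.finite_toSet s.inits).subset fun t ht => by simpa using ht

namespace Strat

variable {A : Game.{u}} {σ τ ρ : Strat A}

/-! ### Constructions of strategies -/

/-- The sub-strategy given by a set of plays. -/
def restrict (τ : Strat A) (S : Set (List A.Move)) (hS : S ⊆ τ.plays) (h0 : [] ∈ S)
    (h1 : ∀ s t, EvenPrefix s t → t ∈ S → s ∈ S) : Strat A where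
  plays := S
  isStrategy := τ.isStrategy.mono hS ⟨[], h0⟩ h1

/-- `q` is an Opponent move at a position of `ρ` to which `ρ` gives no answer. -/
def IsCell (ρ : Strat A) (q : List A.Move) : Prop :=
  q ∈ A.plays ∧ (∃ p a, q = p ++ [a] ∧ Even p.length ∧ p ∈ ρ.plays) ∧ ∀ b, q ++ [b] ∉ ρ.plays

theorem IsCell.odd {q : List A.Move} (h : ρ.IsCell q) : Odd q.length := by
  obtain ⟨-, ⟨p, a, rfl, hp, -⟩, -⟩ := h
  exact odd_length_concat.2 hp

theorem isCell_of_mem {q : List A.Move} (h : q ∈ ρ.plays) (ho : Odd q.length) : ρ.IsCell q := by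
  refine ⟨ρ.isStrategy.subset_plays h, ?_, fun b hb => ρ.isStrategy.notMem_of_concat_mem ho hb h⟩
  obtain ⟨p, a, rfl, hp⟩ := exists_eq_concat_of_odd ho
  exact ⟨p, a, rfl, hp, mem_of_even_prefix h (List.prefix_append _ _) hp⟩

theorem IsCell.of_coh {q : List A.Move} (h : ρ.IsCell q) (k : ρ.Coh σ) : σ.IsCell q := by
  have ho := h.odd
  obtain ⟨h1, ⟨p, a, rfl, hp, hpρ⟩, h2⟩ := h
  exact ⟨h1, ⟨p, a, rfl, hp, k.mem hpρ hp⟩,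
    fun b hb => h2 b (k.symm.mem hb (even_length_concat.2 ho))⟩

/-- Escape at a set of unanswered Opponent moves. -/
def addCells (ρ : Strat A) (Q : Set (List A.Move)) (hQ : ∀ q ∈ Q, ρ.IsCell q) : Strat A where
  plays := ρ.plays ∪ Q
  isStrategy := by
    have hl : ∀ s ∈ ρ.plays ∪ Q, Even s.length → s ∈ ρ.plays := by
      rintro s (hs | hs) he
      exacts [hs, absurd he (Nat.not_even_iff_odd.2 (hQ s hs).odd)]
    refine .of_det (Set.union_subset ρ.isStrategy.subset_plays fun q hq => (hQ q hq).1)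
      (Or.inl ρ.isStrategy.nil_mem) ?_ ?_ ?_
    · rintro s t hst he (ht | ht)
      · exact Or.inl (mem_of_even_prefix ht hst he)
      · obtain ⟨-, ⟨p, a, rfl, hp, hpρ⟩, -⟩ := hQ t ht
        rcases List.prefix_concat_iff.1 hst with rfl | h
        · exact absurd (even_length_concat.1 he) (Nat.not_odd_iff_even.2 hp)
        · exact Or.inl (mem_of_even_prefix hpρ h he)
    · intro w x ho hx
      have := hl _ hx (even_length_concat.2 ho)
      rintro (hw | hw)
      exacts [ρ.isStrategy.notMem_of_concat_mem ho this hw, (hQ w hw).2.2 x this]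
    · intro w x y ho hx hy
      exact ρ.isStrategy.concat_inj ho (hl _ hx (even_length_concat.2 ho))
        (hl _ hy (even_length_concat.2 ho))

theorem incl_addCells {Q : Set (List A.Move)} (hQ : ∀ q ∈ Q, ρ.IsCell q) :
    ρ.Incl (ρ.addCells Q hQ) := Set.subset_union_left

theorem coh_addCells {Q : Set (List A.Move)} (hQ : ∀ q ∈ Q, ρ.IsCell q) :
    ρ.Coh (ρ.addCells Q hQ) :=
  coh_of_forall fun _ he => ⟨Or.inl, fun hs => hs.elim id fun hs =>
    absurd he (Nat.not_even_iff_odd.2 (hQ _ hs).odd)⟩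

theorem addCells_empty (h : ∀ q ∈ (∅ : Set (List A.Move)), ρ.IsCell q) : ρ.addCells ∅ h = ρ :=
  Strat.ext (Set.union_empty _)

theorem IsCell.forall_mem_singleton {q : List A.Move} (h : ρ.IsCell q) :
    ∀ r ∈ ({q} : Set (List A.Move)), ρ.IsCell r := by
  rintro _ rfl
  exact h

/-- Escape at one unanswered Opponent move. -/
abbrev addCell (ρ : Strat A) {q : List A.Move} (h : ρ.IsCell q) : Strat A :=
  ρ.addCells {q} h.forall_mem_singleton

/-- `ρ`, made to escape at those unanswered Opponent moves to which `τ` reacts. -/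
def cover (ρ τ : Strat A) : Strat A :=
  ρ.addCells {q | ρ.IsCell q ∧ (q ∈ τ.plays ∨ ∃ b, q ++ [b] ∈ τ.plays)} fun _ h => h.1

theorem incl_cover : ρ.Incl (ρ.cover τ) := incl_addCells _

theorem coh_cover : ρ.Coh (ρ.cover τ) := coh_addCells _

/-- A play of `τ` is followed until it leaves `ρ`. It does so at an unanswered Opponent move to
which `τ` reacts, and there the cover escapes. -/
theorem Incl.le_cover (h : ρ.Incl τ) : τ ≤ ρ.cover τ := by
  have key : ∀ s : List A.Move, Even s.length → s ∈ τ.plays → s ∈ ρ.plays ∨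
      ∃ q, Odd q.length ∧ q <+: s ∧ q ∈ (ρ.cover τ).plays := by
    refine even_concat_induction (fun _ => Or.inl ρ.isStrategy.nil_mem) fun p a b hp ih hs => ?_
    have hps : p <+: p ++ [a, b] := List.prefix_append _ _
    rcases ih (mem_of_even_prefix hs hps hp) with hpρ | ⟨q, ho, hq, hqc⟩
    · have ho : Odd (p ++ [a]).length := odd_length_concat.2 hp
      have hs' : (p ++ [a]) ++ [b] ∈ τ.plays := by simpa using hs
      by_cases hb : (p ++ [a]) ++ [b] ∈ ρ.plays
      · exact Or.inl (by simpa using hb)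
      · refine Or.inr ⟨p ++ [a], ho, ⟨[b], by simp⟩, Or.inr ⟨⟨?_, ⟨p, a, rfl, hp, hpρ⟩,
          fun b' hb' => hb ?_⟩, Or.inr ⟨b, hs'⟩⟩⟩
        · exact A.prefix_closed _ _ (List.prefix_append _ _) (τ.isStrategy.subset_plays hs')
        · rwa [τ.isStrategy.concat_inj ho hs' (h hb')]
    · exact Or.inr ⟨q, ho, hq.trans hps, hqc⟩
  intro s hs
  rcases Nat.even_or_odd s.length with he | ho
  · rcases key s he hs with hs' | ⟨q, hq, hqs, hqc⟩
    · exact ⟨s, incl_cover hs', PlayLE.refl s⟩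
    · exact ⟨q, hqc, Or.inr ⟨hq, hqs⟩⟩
  · obtain ⟨p, a, rfl, hp⟩ := exists_eq_concat_of_odd ho
    have hpa : p <+: p ++ [a] := List.prefix_append _ _
    rcases key p hp (mem_of_even_prefix hs hpa hp) with hpρ | ⟨q, hq, hqs, hqc⟩
    · refine ⟨_, Or.inr ⟨⟨τ.isStrategy.subset_plays hs, ⟨p, a, rfl, hp, hpρ⟩, fun b hb => ?_⟩,
        Or.inl hs⟩, PlayLE.refl _⟩
      exact τ.isStrategy.notMem_of_concat_mem ho (h hb) hs
    · exact ⟨q, hqc, Or.inr ⟨hq, hqs.trans hpa⟩⟩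

/-- Where both `σ` and `τ` react, their common bound `ρ` makes them react alike, so the reaction is
already in the intersection and no escape is added to both covers. -/
theorem cover_inter_cover (hσ : σ.Incl ρ) (hτ : τ.Incl ρ) :
    ((σ.inter τ).cover σ).inter ((σ.inter τ).cover τ) = σ.inter τ := by
  refine Incl.antisymm ?_ fun s hs => ⟨Or.inl hs, Or.inl hs⟩
  rintro s ⟨hs | ⟨hc, hs⟩, hs' | ⟨-, hs'⟩⟩
  · exact hs
  · exact hs
  · exact hs'
  · rcases hs with hs | ⟨b, hs⟩ <;> rcases hs' with hs' | ⟨b', hs'⟩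
    · exact ⟨hs, hs'⟩
    · exact absurd (hσ hs) (ρ.isStrategy.notMem_of_concat_mem hc.odd (hτ hs'))
    · exact absurd (hτ hs') (ρ.isStrategy.notMem_of_concat_mem hc.odd (hσ hs))
    · obtain rfl := ρ.isStrategy.concat_inj hc.odd (hσ hs) (hτ hs')
      exact absurd ⟨hs, hs'⟩ (hc.2.2 b)

/-! ### Directed sets with respect to inclusion -/

theorem directedOn_le_of_incl {S : Set (Strat A)} (hS : DirectedOn Incl S) :
    DirectedOn (· ≤ ·) S :=
  hS.mono fun _ _ h => Incl.le h

/-- For a set directed by inclusion no play ever disappears, again by convexity of membership, so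
the limit is the least upper bound in both senses. -/
theorem isInclLUB_iff {S : Set (Strat A)} (h0 : S.Nonempty) (hS : DirectedOn Incl S) :
    IsInclLUB S σ ↔ IsLUB S σ := by
  have hS' := directedOn_le_of_incl hS
  have hL : IsInclLUB S (lim S h0 hS') := by
    refine ⟨fun τ hτ s hs => ⟨τ, hτ, fun τ' hτ' hle => ?_⟩,
      fun ρ hρ s ⟨τ, hτ, hs⟩ => hρ τ hτ (hs τ hτ le_rfl)⟩
    obtain ⟨ρ, -, h, k⟩ := hS τ hτ τ' hτ'
    exact mem_of_le_of_le hle (Incl.le k) hs (h hs)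
  constructor
  · intro h
    rw [Incl.antisymm (h.2 _ hL.1) (hL.2 _ h.1)]
    exact isLUB_lim h0 hS'
  · intro h
    rwa [h.unique (isLUB_lim h0 hS')]

/-- The finite sub-strategies of a strategy. -/
def finiteSubs (τ : Strat A) : Set (Strat A) := {σ | σ.Incl τ ∧ σ.plays.Finite}

theorem finiteSubs_nonempty : τ.finiteSubs.Nonempty :=
  ⟨⟨{[]}, isStrategy_singleton_nil A⟩, by
    rintro _ rfl
    exact τ.isStrategy.nil_mem, Set.finite_singleton _⟩

theorem directedOn_finiteSubs : DirectedOn Incl τ.finiteSubs := by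
  rintro σ ⟨hσ, hσf⟩ σ' ⟨hσ', hσf'⟩
  refine ⟨τ.restrict (σ.plays ∪ σ'.plays) (Set.union_subset hσ hσ') (Or.inl σ.isStrategy.nil_mem)
    ?_, ⟨Set.union_subset hσ hσ', hσf.union hσf'⟩, Set.subset_union_left, Set.subset_union_right⟩
  rintro s t hst (ht | ht)
  exacts [Or.inl (σ.isStrategy.even_prefix_closed s t hst ht),
    Or.inr (σ'.isStrategy.even_prefix_closed s t hst ht)]

theorem isInclLUB_finiteSubs : IsInclLUB τ.finiteSubs τ := by
  refine ⟨fun _ h => h.1, fun ρ hρ s hs => ?_⟩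
  have hsub : {t | EvenPrefix t s} ⊆ τ.plays := fun t ht =>
    τ.isStrategy.even_prefix_closed t s ht hs
  exact hρ (τ.restrict {t | EvenPrefix t s} hsub (Or.inl ⟨List.nil_prefix, by simp⟩)
    fun _ _ h k => h.trans k) ⟨hsub, (finite_prefixes s).subset fun _ h => h.isPrefix⟩ (Or.inr rfl)

end Strat

open Strat

/-! ### Continuous bistable functions are stable -/

section Stable

variable {A B : Game.{u}} {f : Strat A → Strat B} {σ τ ρ : Strat A}

theorem IsBistable.map_inter (hb : IsBistable Coh Coh f) (h : σ.Coh τ) :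
    f (σ.inter τ) = (f σ).inter (f τ) :=
  ((hb σ τ h).2.1 _ h.isGLB_inter).unique (Coh.isGLB_inter (hb σ τ h).1)

theorem IsBistable.map_union (hb : IsBistable Coh Coh f) (h : σ.Coh τ) :
    f (σ.union τ h) = (f σ).union (f τ) (hb σ τ h).1 :=
  ((hb σ τ h).2.2 _ h.isLUB_union).unique (Coh.isLUB_union (hb σ τ h).1)

theorem map_incl (hc : ScottContinuous f) (hb : IsBistable Coh Coh f) (h : σ.Incl τ) :
    (f σ).Incl (f τ) :=
  Coh.incl_of_le_of_le (hb _ _ coh_cover).1 (hc.monotone h.le) (hc.monotone h.le_cover)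

theorem isStable_of_continuous_of_isBistable (hc : ScottContinuous f)
    (hb : IsBistable Coh Coh f) : IsStable f where
  continuous S h0 hS σ hσ := by
    have hfS : DirectedOn Incl (f '' S) := by
      rintro _ ⟨x, hx, rfl⟩ _ ⟨y, hy, rfl⟩
      obtain ⟨z, hz, h, k⟩ := hS x hx y hy
      exact ⟨f z, ⟨z, hz, rfl⟩, map_incl hc hb h, map_incl hc hb k⟩
    exact (isInclLUB_iff (h0.image f) hfS).2
      (hc h0 (directedOn_le_of_incl hS) ((isInclLUB_iff h0 hS).1 hσ))
  multiplicative σ σ' τ h h' := by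
    refine le_antisymm (Incl.le fun s hs =>
      ⟨map_incl hc hb inter_incl_left hs, map_incl hc hb inter_incl_right hs⟩) ?_
    have hcoh : ((σ.inter σ').cover σ).Coh ((σ.inter σ').cover σ') :=
      coh_cover.symm.trans coh_cover
    -- The two covers express `σ ∩ σ'` as a coherent meet, which `f` preserves.
    have hf := hb.map_inter hcoh
    rw [cover_inter_cover h h'] at hf
    rw [hf]
    refine (Coh.isGLB_inter (hb _ _ hcoh).1).2 ?_
    rintro _ (rfl | rfl)
    · exact inter_incl_left.le.trans (hc.monotone inter_incl_left.le_cover)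
    · exact inter_incl_right.le.trans (hc.monotone inter_incl_right.le_cover)

/-! ### The trace of a continuous bistable function -/

theorem tr_unique {t : List B.Move} (hσ : (σ, t) ∈ tr f) (hτ : (τ, t) ∈ tr f)
    (h : σ.Compat τ) : σ = τ :=
  (hσ.2 τ h hτ.1).antisymm (hτ.2 σ h.symm hσ.1)

/-- Continuity gives a finite part of `τ` producing `t`. One of least cardinality is minimal against
every compatible strategy, since by stability the intersection with it still produces `t`. -/
theorem exists_mem_tr (hc : ScottContinuous f) (hb : IsBistable Coh Coh f) {t : List B.Move}
    (ht : t ∈ (f τ).plays) : ∃ σ : Strat A, σ.Incl τ ∧ σ.plays.Finite ∧ (σ, t) ∈ tr f := by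
  have hd := directedOn_finiteSubs (τ := τ)
  have hlub := hc finiteSubs_nonempty (directedOn_le_of_incl hd)
    ((isInclLUB_iff finiteSubs_nonempty hd).1 isInclLUB_finiteSubs)
  have hdf : DirectedOn (· ≤ ·) (f '' τ.finiteSubs) := by
    rintro _ ⟨x, hx, rfl⟩ _ ⟨y, hy, rfl⟩
    obtain ⟨z, hz, h, k⟩ := hd x hx y hy
    exact ⟨f z, ⟨z, hz, rfl⟩, hc.monotone (Incl.le h), hc.monotone (Incl.le k)⟩
  obtain ⟨_, ⟨σ, hσ, rfl⟩, htσ⟩ := (mem_lub_iff (finiteSubs_nonempty.image f) hdf hlub).1 ht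
  have hne : {σ ∈ τ.finiteSubs | t ∈ (f σ).plays}.Nonempty :=
    ⟨σ, hσ, htσ _ ⟨σ, hσ, rfl⟩ le_rfl⟩
  obtain ⟨ρ, ⟨⟨hρ, hfin⟩, htρ⟩, hmin⟩ :=
    WellFounded.has_min (measure fun σ : Strat A => σ.plays.ncard).wf _ hne
  refine ⟨ρ, hρ, hfin, htρ, ?_⟩
  rintro κ ⟨υ, h, k⟩ htκ
  have hmem : t ∈ (f (ρ.inter κ)).plays := by
    rw [(isStable_of_continuous_of_isBistable hc hb).multiplicative ρ κ υ h k]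
    exact ⟨htρ, htκ⟩
  have := hmin (ρ.inter κ) ⟨⟨inter_incl_left.trans hρ, hfin.subset inter_incl_left⟩, hmem⟩
  have heq := Set.eq_of_subset_of_ncard_le inter_incl_left (not_lt.1 this) hfin
  exact fun s hs => (heq.symm ▸ hs : s ∈ (ρ.inter κ).plays).2

theorem finite_of_mem_tr (hc : ScottContinuous f) (hb : IsBistable Coh Coh f)
    {t : List B.Move} (h : (τ, t) ∈ tr f) : τ.plays.Finite := by
  obtain ⟨σ, hσ, hfin, ht⟩ := exists_mem_tr hc hb h.1
  rwa [tr_unique h ht (Incl.compat hσ).symm]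

/-- Dropping the escapes of the argument stays in the same coherence class, so it keeps the answers
of the output; minimality does the rest. -/
theorem eq_evenPart_of_mem_tr (hb : IsBistable Coh Coh f) {t : List B.Move}
    (h : (τ, t) ∈ tr f) (ht : Even t.length) : τ = τ.evenPart :=
  Incl.antisymm (h.2 _ (Incl.compat evenPart_incl).symm
    (Coh.mem (hb _ _ coh_evenPart).1 h.1 ht)) evenPart_incl

/-- This is where preservation of joins enters: finitely many escapes form an iterated coherent
join, and `f` sends it to a union. -/
theorem mem_map_addCells (hb : IsBistable Coh Coh f) {t : List B.Move} {Q : Set (List A.Move)}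
    (hfin : Q.Finite) : ∀ hQ : ∀ q ∈ Q, ρ.IsCell q, t ∈ (f (ρ.addCells Q hQ)).plays →
      t ∈ (f ρ).plays ∨ ∃ q ∈ Q, ∃ h : ρ.IsCell q, t ∈ (f (ρ.addCell h)).plays := by
  induction Q, hfin using Set.Finite.induction_on with
  | empty =>
    intro hQ ht
    rw [addCells_empty] at ht
    exact Or.inl ht
  | @insert q Q _ _ ih =>
    intro hQ ht
    have hq : ρ.IsCell q := hQ q (Or.inl rfl)
    have hQ' : ∀ q ∈ Q, ρ.IsCell q := fun q hq => hQ q (Or.inr hq)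
    have hcoh : (ρ.addCell hq).Coh (ρ.addCells Q hQ') :=
      (coh_addCells _).symm.trans (coh_addCells _)
    have heq : ρ.addCells (insert q Q) hQ = (ρ.addCell hq).union (ρ.addCells Q hQ') hcoh := by
      refine Strat.ext ?_
      change ρ.plays ∪ insert q Q = (ρ.plays ∪ {q}) ∪ (ρ.plays ∪ Q)
      rw [Set.insert_eq, Set.union_union_distrib_left]
    rw [heq, hb.map_union] at ht
    rcases ht with ht | ht
    · exact Or.inr ⟨q, Or.inl rfl, hq, ht⟩
    · rcases ih hQ' ht with h | ⟨q', hq', h⟩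
      · exact Or.inl h
      · exact Or.inr ⟨q', Or.inr hq', h⟩

/-- At most one odd-length play is needed to produce an output. -/
theorem eq_evenPart_or_insert_of_mem_tr (hc : ScottContinuous f) (hb : IsBistable Coh Coh f)
    {t : List B.Move} (h : (τ, t) ∈ tr f) :
    τ = τ.evenPart ∨ ∃ q, Odd q.length ∧ τ.plays = insert q τ.evenPart.plays := by
  have hQ : ∀ q ∈ {q ∈ τ.plays | Odd q.length}, τ.evenPart.IsCell q := fun q hq =>
    (isCell_of_mem hq.1 hq.2).of_coh coh_evenPart
  have heq : τ.evenPart.addCells _ hQ = τ := by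
    refine Strat.ext (Set.ext fun s => ⟨?_, fun hs => ?_⟩)
    · rintro (hs | hs)
      exacts [hs.1, hs.1]
    · rcases Nat.even_or_odd s.length with he | ho
      exacts [Or.inl ⟨hs, he⟩, Or.inr ⟨hs, ho⟩]
  have ht := h.1
  simp only at ht
  rw [← heq] at ht
  rcases mem_map_addCells hb ((finite_of_mem_tr hc hb h).subset (Set.sep_subset _ _)) hQ ht with
    ht | ⟨q, ⟨hq, ho⟩, hcell, ht⟩
  · exact Or.inl (Incl.antisymm (h.2 _ (Incl.compat evenPart_incl).symm ht) evenPart_incl)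
  · refine Or.inr ⟨q, ho, ?_⟩
    have hincl : (τ.evenPart.addCell hcell).Incl τ := by
      rintro s (hs | rfl)
      exacts [hs.1, hq]
    rw [← Set.union_singleton]
    exact congrArg Strat.plays ((h.2 _ (Incl.compat hincl).symm ht).antisymm hincl)

/-! ### Sequentiality of the trace -/

theorem concat_mem_of_odd_prefix {υ : Strat B} {t u : List B.Move} {a : B.Move}
    (he : Even t.length) (ht : t ∈ υ.plays) (hu : u ∈ υ.plays) (ho : Odd u.length)
    (h : u <+: t ++ [a]) : t ++ [a] ∈ υ.plays := by
  rwa [← odd_prefix_of_prefix_concat h fun h' => ?_]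
  rw [eq_of_odd_prefix hu ht ho h'] at ho
  exact Nat.not_even_iff_odd.2 ho he

/-- The output of the token must be dominated in `f (ρ.cover τ)`. An answer there would already
belong to `f ρ`, against minimality of `τ`; so there is an escape, and it cannot come before `t ++
[a]` because `t` is present. -/
theorem concat_mem_map_cover (hc : ScottContinuous f) (hb : IsBistable Coh Coh f)
    {t : List B.Move} {a : B.Move} (he : Even t.length)
    (hτ : (∃ b, (τ, t ++ [a, b]) ∈ tr f) ∨ (τ, t ++ [a]) ∈ tr f) (h : ρ.Incl τ)
    (hne : ¬ τ.Incl ρ) (ht : t ∈ (f ρ).plays) : t ++ [a] ∈ (f (ρ.cover τ)).plays := by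
  have ht' : t ∈ (f (ρ.cover τ)).plays := map_incl hc hb incl_cover ht
  rcases hτ with ⟨b, hτ⟩ | hτ
  · have hab : t ++ [a, b] = (t ++ [a]) ++ [b] := by simp
    have heab : Even (t ++ [a, b]).length := by
      rw [hab]
      exact even_length_concat.2 (odd_length_concat.2 he)
    obtain ⟨u, hu, ⟨-, hp⟩ | ⟨ho, hp⟩⟩ := hc.monotone h.le_cover _ hτ.1
    · have h1 := mem_of_even_prefix hu hp heab
      have h2 := Coh.mem (hb _ _ coh_cover.symm).1 h1 heab
      exact absurd (hτ.2 ρ (Incl.compat h).symm h2) hne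
    · simp only [hab] at hp
      rcases List.prefix_concat_iff.1 hp with rfl | hp
      · rw [← hab] at ho
        exact absurd heab (Nat.not_even_iff_odd.2 ho)
      · exact concat_mem_of_odd_prefix he ht' hu ho hp
  · obtain ⟨u, hu, ⟨h', -⟩ | ⟨ho, hp⟩⟩ := hc.monotone h.le_cover _ hτ.1
    · exact absurd (even_length_concat.1 h') (Nat.not_odd_iff_even.2 he)
    · exact concat_mem_of_odd_prefix he ht' hu ho hp

theorem concat_notMem_map_of_incl (hc : ScottContinuous f) (hb : IsBistable Coh Coh f)
    {t : List B.Move} {a : B.Move} (he : Even t.length)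
    (hτ : (∃ b, (τ, t ++ [a, b]) ∈ tr f) ∨ (τ, t ++ [a]) ∈ tr f) (h : ρ.Incl τ)
    (hne : ¬ τ.Incl ρ) : t ++ [a] ∉ (f ρ).plays := by
  intro ht
  rcases hτ with ⟨b, hτ⟩ | hτ
  · exact (f τ).isStrategy.notMem_of_concat_mem (x := b) (odd_length_concat.2 he)
      (by simpa using hτ.1) (map_incl hc hb h ht)
  · exact hne (hτ.2 ρ (Incl.compat h).symm ht)

/-- If a proper part of the even-length plays of `τ` produces `t`, then some play of `τ` answers
an Opponent move at which escaping makes the output escape. -/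
theorem exists_cell_of_mem_tr (hc : ScottContinuous f) (hb : IsBistable Coh Coh f)
    {t : List B.Move} {a : B.Move} (he : Even t.length)
    (hτ : (∃ b, (τ, t ++ [a, b]) ∈ tr f) ∨ (τ, t ++ [a]) ∈ tr f) (h : ρ.Incl τ.evenPart)
    (hne : ¬ τ.evenPart.Incl ρ) (ht : t ∈ (f ρ).plays) :
    ∃ q d, ∃ hq : ρ.IsCell q, q ++ [d] ∈ τ.plays ∧ t ++ [a] ∈ (f (ρ.addCell hq)).plays := by
  have hρτ := h.trans evenPart_incl
  have hne' : ¬ τ.Incl ρ := fun h' => hne (evenPart_incl.trans h')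
  have hfin : τ.plays.Finite := by
    rcases hτ with ⟨b, hτ⟩ | hτ
    exacts [finite_of_mem_tr hc hb hτ, finite_of_mem_tr hc hb hτ]
  have hQ : {q | ρ.IsCell q ∧ (q ∈ τ.plays ∨ ∃ b, q ++ [b] ∈ τ.plays)}.Finite := by
    refine (hfin.union (hfin.image List.dropLast)).subset ?_
    rintro q ⟨-, hq | ⟨b, hq⟩⟩
    exacts [Or.inl hq, Or.inr ⟨_, hq, by simp⟩]
  rcases mem_map_addCells hb hQ _ (concat_mem_map_cover hc hb he hτ hρτ hne' ht) with
    hta | ⟨q, ⟨-, hq | ⟨d, hq⟩⟩, hcell, hta⟩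
  · exact absurd hta (concat_notMem_map_of_incl hc hb he hτ hρτ hne')
  · refine absurd hta (concat_notMem_map_of_incl hc hb he hτ ?_ fun h' => hne fun s hs => ?_)
    · rintro s (hs | rfl)
      exacts [hρτ hs, hq]
    · rcases h' hs.1 with h' | rfl
      exacts [h', absurd hs.2 (Nat.not_even_iff_odd.2 hcell.odd)]
  · exact ⟨q, d, hcell, hq, hta⟩

/-- If `κ` ignored `q`, then `ρ` with an escape at `q` and `κ` would both lie in `κ` with that
escape and meet in `ρ`, so stability would put `t` into `f ρ`. -/
theorem mem_of_concat_mem_map_addCell (hs : IsStable f) {t : List B.Move} {κ : Strat A}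
    {q : List A.Move} (hq : ρ.IsCell q) (hρ : t ∉ (f ρ).plays)
    (ht : t ∈ (f (ρ.addCell hq)).plays) (hκ : t ∈ (f κ).plays) (hρκ : ρ.Incl κ)
    (hqκ : ∀ b, q ++ [b] ∉ κ.plays) : q ∈ κ.plays := by
  by_contra hn
  have hcell : κ.IsCell q :=
    ⟨hq.1, hq.2.1.imp fun p ⟨c, h1, h2, h3⟩ => ⟨c, h1, h2, hρκ h3⟩, hqκ⟩
  have h1 : (ρ.addCell hq).Incl (κ.addCell hcell) := Set.union_subset_union_left _ hρκ
  have h2 := hs.multiplicative _ _ _ h1 (incl_addCells hcell.forall_mem_singleton)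
  refine hρ ?_
  have h3 : (ρ.addCell hq).inter κ = ρ := by
    refine Incl.antisymm ?_ fun s hs => ⟨Or.inl hs, hρκ hs⟩
    rintro s ⟨hs | rfl, hs'⟩
    exacts [hs, absurd hs' hn]
  rw [h3] at h2
  rw [h2]
  exact ⟨ht, hκ⟩

/-- `ρ` is a part of the argument that is needed for `t ++ [a]`. It grows by one answer of `τ` at a
time, keeping this property, until a single answer is missing. -/
theorem exists_last_query (hc : ScottContinuous f) (hb : IsBistable Coh Coh f)
    {t : List B.Move} {a : B.Move} (he : Even t.length)
    (hτ : (∃ b, (τ, t ++ [a, b]) ∈ tr f) ∨ (τ, t ++ [a]) ∈ tr f) :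
    ∀ n : ℕ, ∀ ρ : Strat A, (τ.evenPart.plays \ ρ.plays).ncard ≤ n → ρ.Incl τ.evenPart →
      ¬ τ.evenPart.Incl ρ → t ∈ (f ρ).plays →
      (∀ κ : Strat A, ρ.Compat κ → t ++ [a] ∈ (f κ).plays → ρ.Incl κ) →
      ∃ q p c d, q ∈ τ.evenPart.plays ∧ q = p ++ [c, d] ∧
        ∃ σ : Strat A, σ.plays = (τ.evenPart.plays \ {q}) ∪ {p ++ [c]} ∧
          (σ, t ++ [a]) ∈ tr f := by
  have hst := isStable_of_continuous_of_isBistable hc hb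
  have hfin : τ.evenPart.plays.Finite := by
    rcases hτ with ⟨b, hτ⟩ | hτ
    exacts [(finite_of_mem_tr hc hb hτ).subset evenPart_incl,
      (finite_of_mem_tr hc hb hτ).subset evenPart_incl]
  intro n
  induction n with
  | zero =>
    intro ρ hn _ hne _ _
    rw [Nat.le_zero, Set.ncard_eq_zero (hfin.subset Set.sdiff_subset), Set.sdiff_eq_empty] at hn
    exact absurd hn hne
  | succ n ih =>
    intro ρ hn hρ hne ht hmin
    obtain ⟨q, d, hq, hd, hta⟩ := exists_cell_of_mem_tr hc hb he hτ hρ hne ht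
    have hde : Even (q ++ [d]).length := even_length_concat.2 hq.odd
    have hdτ : q ++ [d] ∈ τ.evenPart.plays := ⟨hd, hde⟩
    have hnta : t ++ [a] ∉ (f ρ).plays := concat_notMem_map_of_incl hc hb he hτ
      (hρ.trans evenPart_incl) fun h => hne (evenPart_incl.trans h)
    obtain ⟨p, c, rfl, hp, hpρ⟩ := hq.2.1
    have hsub : insert (p ++ [c] ++ [d]) ρ.plays ⊆ τ.evenPart.plays :=
      Set.insert_subset hdτ hρ
    let ρ' : Strat A := τ.evenPart.restrict (insert (p ++ [c] ++ [d]) ρ.plays) hsub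
      (Or.inr ρ.isStrategy.nil_mem) (by
        rintro s t (⟨hst, hse⟩ | rfl) (rfl | hs)
        · rcases List.prefix_concat_iff.1 hst with rfl | hst
          · exact Or.inl rfl
          · rcases List.prefix_concat_iff.1 hst with rfl | hst
            · exact absurd hq.odd (Nat.not_odd_iff_even.2 hse)
            · exact Or.inr (mem_of_even_prefix hpρ hst hse)
        · exact Or.inr (mem_of_even_prefix hs hst hse)
        · exact Or.inl rfl
        · exact Or.inr hs)
    have hρρ' : ρ.Incl ρ' := Set.subset_insert _ _
    -- If only this answer was missing, `ρ` escaping at `p ++ [c]` is the required token; otherwise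
    -- the answer is added and the search goes on.
    by_cases heq : τ.evenPart.Incl ρ'
    · have heq' : τ.evenPart.plays = insert (p ++ [c] ++ [d]) ρ.plays :=
        Set.Subset.antisymm heq hsub
      refine ⟨p ++ [c] ++ [d], p, c, d, hdτ, by simp, ρ.addCell hq, ?_, hta, fun κ hκ hκt => ?_⟩
      · rw [heq', Set.insert_sdiff_of_mem _ (Set.mem_singleton _), Set.sdiff_singleton_eq_self (hq.2.2 d)]
        rfl
      · have hρκ := hmin κ (hκ.symm.of_incl_right (incl_addCells hq.forall_mem_singleton)).symm hκt
        obtain ⟨υ, h1, h2⟩ := hκ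
        rintro s (hs | rfl)
        · exact hρκ hs
        · exact mem_of_concat_mem_map_addCell hst hq hnta hta hκt hρκ fun b hb =>
            υ.isStrategy.notMem_of_concat_mem hq.odd (h2 hb) (h1 (Or.inr rfl))
    · refine ih ρ' ?_ hsub heq (map_incl hc hb hρρ' ht) fun κ hκ hκt => ?_
      · have hlt : (τ.evenPart.plays \ ρ'.plays).ncard < (τ.evenPart.plays \ ρ.plays).ncard := by
          refine Set.ncard_lt_ncard ⟨Set.sdiff_subset_sdiff_right hρρ', fun h => ?_⟩
            (hfin.subset Set.sdiff_subset)
          exact (h ⟨hdτ, hq.2.2 d⟩).2 (Or.inl rfl)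
        omega
      · have hρκ := hmin κ (hκ.symm.of_incl_right hρρ').symm hκt
        obtain ⟨υ, h1, h2⟩ := hκ
        have hυ : p ++ [c] ++ [d] ∈ υ.plays := h1 (Or.inl rfl)
        refine Set.insert_subset ?_ hρκ
        -- Without the answer of `τ`, `κ` could only escape at `p ++ [c]`, which is incompatible
        -- with `ρ'`.
        by_contra hn
        have := mem_of_concat_mem_map_addCell hst hq hnta hta hκt hρκ fun b hb => hn (by
          rwa [υ.isStrategy.concat_inj hq.odd hυ (h2 hb)])
        exact υ.isStrategy.notMem_of_concat_mem hq.odd hυ (h2 this)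

theorem exists_query_of_mem_tr (hc : ScottContinuous f) (hb : IsBistable Coh Coh f)
    {t : List B.Move} {a : B.Move} (he : Even t.length)
    (hτ : (∃ b, (τ, t ++ [a, b]) ∈ tr f) ∨ (τ, t ++ [a]) ∈ tr f) :
    (τ.evenPart, t) ∈ tr f ∨ ∃ q p c d, q ∈ τ.evenPart.plays ∧ q = p ++ [c, d] ∧
      ∃ σ : Strat A, σ.plays = (τ.evenPart.plays \ {q}) ∪ {p ++ [c]} ∧ (σ, t ++ [a]) ∈ tr f := by
  have ht : t ∈ (f τ.evenPart).plays := by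
    refine Coh.mem (hb _ _ coh_evenPart).1 ?_ he
    rcases hτ with ⟨b, hτ⟩ | hτ
    exacts [mem_of_even_prefix hτ.1 (List.prefix_append _ _) he,
      mem_of_even_prefix hτ.1 (List.prefix_append _ _) he]
  obtain ⟨ρ, hρ, -, htr⟩ := exists_mem_tr hc hb ht
  by_cases heq : τ.evenPart.Incl ρ
  · exact Or.inl (heq.antisymm hρ ▸ htr)
  · exact Or.inr (exists_last_query hc hb he hτ _ ρ le_rfl hρ heq htr.1 fun κ hκ hκt =>
      htr.2 κ hκ (mem_of_even_prefix hκt (List.prefix_append _ _) he))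

/-- Let `ρ` be the common answers of `σ` and `σ'`. With escapes at both queries `ρ` lies above `σ`,
so it produces `t ++ [a]`; by joins one escape suffices. That smaller strategy lacks the answer to
the other query, against minimality. -/
theorem query_unique (hc : ScottContinuous f) (hb : IsBistable Coh Coh f)
    {t : List B.Move} {a : B.Move} (he : Even t.length) {p p' : List A.Move} {c d c' d' : A.Move}
    {E : Strat A} (hE : ∀ s ∈ E.plays, Even s.length)
    (hq : p ++ [c, d] ∈ E.plays) (hq' : p' ++ [c', d'] ∈ E.plays)
    {σ σ' : Strat A} (hσ : σ.plays = (E.plays \ {p ++ [c, d]}) ∪ {p ++ [c]})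
    (hσ' : σ'.plays = (E.plays \ {p' ++ [c', d']}) ∪ {p' ++ [c']})
    (htr : (σ, t ++ [a]) ∈ tr f) (htr' : (σ', t ++ [a]) ∈ tr f) : p ++ [c, d] = p' ++ [c', d'] := by
  by_contra hne
  -- the two situations are symmetric
  have side : ∀ {p p' : List A.Move} {c d c' d' : A.Move} {σ σ' : Strat A},
      p ++ [c, d] ∈ E.plays → p' ++ [c', d'] ∈ E.plays →
      σ.plays = (E.plays \ {p ++ [c, d]}) ∪ {p ++ [c]} →
      σ'.plays = (E.plays \ {p' ++ [c', d']}) ∪ {p' ++ [c']} → p ++ [c, d] ≠ p' ++ [c', d'] →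
      σ.evenPart.plays = E.plays \ {p ++ [c, d]} ∧
      (σ.evenPart.inter σ'.evenPart).IsCell (p ++ [c]) := by
    intro p p' c d c' d' σ σ' hq hq' hσ hσ' hne
    have ev : ∀ {p p' : List A.Move} {c d : A.Move} {σ : Strat A}, p ++ [c, d] ∈ E.plays →
        σ.plays = (E.plays \ {p ++ [c, d]}) ∪ {p ++ [c]} →
        Even p.length ∧ σ.evenPart.plays = E.plays \ {p ++ [c, d]} := by
      intro p p' c d σ hq hσ
      have hp : Even p.length := by simpa [Nat.even_add_one] using hE _ hq
      refine ⟨hp, Set.ext fun s => ⟨fun hs => ?_, fun hs => ⟨hσ ▸ Or.inl hs, hE s hs.1⟩⟩⟩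
      have h1 := hs.1
      rw [hσ] at h1
      rcases h1 with h1 | rfl
      exacts [h1, absurd (even_length_concat.1 hs.2) (Nat.not_odd_iff_even.2 hp)]
    obtain ⟨hp, h1⟩ := ev (p' := p) hq hσ
    obtain ⟨hp', h1'⟩ := ev (p' := p) hq' hσ'
    refine ⟨h1, ?_⟩
    have hcσ : p ++ [c] ∈ σ.plays := hσ ▸ Or.inr rfl
    have hpσ : p ∈ σ.evenPart.plays :=
      ⟨mem_of_even_prefix hcσ (List.prefix_append _ _) hp, hp⟩
    have hpσ' : p ∈ σ'.evenPart.plays := by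
      have hqσ' : p ++ [c, d] ∈ σ'.evenPart.plays := by
        rw [h1']
        exact ⟨hq, hne⟩
      exact mem_of_even_prefix hqσ' (List.prefix_append _ _) hp
    refine ⟨σ.isStrategy.subset_plays hcσ, ⟨p, c, rfl, hp, hpσ, hpσ'⟩, fun b hb => ?_⟩
    exact σ.isStrategy.notMem_of_concat_mem (odd_length_concat.2 hp) hb.1.1 hcσ
  obtain ⟨hev, hcell⟩ := side hq hq' hσ hσ' hne
  obtain ⟨hev', hcell'⟩ := side hq' hq hσ' hσ (Ne.symm hne)
  have hcomm : σ'.evenPart.inter σ.evenPart = σ.evenPart.inter σ'.evenPart :=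
    Strat.ext (Set.inter_comm _ _)
  rw [hcomm] at hcell'
  set ρ := σ.evenPart.inter σ'.evenPart with hρ
  have hcoh : (ρ.addCell hcell).Coh (ρ.addCell hcell') :=
    (coh_addCells _).symm.trans (coh_addCells _)
  have htσ : t ∈ (f σ.evenPart).plays := Coh.mem (hb _ _ coh_evenPart).1
    (mem_of_even_prefix htr.1 (List.prefix_append _ _) he) he
  have htσ' : t ∈ (f σ'.evenPart).plays := Coh.mem (hb _ _ coh_evenPart).1
    (mem_of_even_prefix htr'.1 (List.prefix_append _ _) he) he
  have htρ : t ∈ (f ρ).plays := by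
    rw [hρ, (isStable_of_continuous_of_isBistable hc hb).multiplicative _ _ E
      (hev.subset.trans Set.sdiff_subset) (hev'.subset.trans Set.sdiff_subset)]
    exact ⟨htσ, htσ'⟩
  have hmemρ : ∀ s ∈ E.plays, s ≠ p ++ [c, d] → s ≠ p' ++ [c', d'] → s ∈ ρ.plays := by
    intro s hs h1 h2
    have k1 : s ∈ σ.evenPart.plays := by
      rw [hev]
      exact ⟨hs, h1⟩
    have k2 : s ∈ σ'.evenPart.plays := by
      rw [hev']
      exact ⟨hs, h2⟩
    exact ⟨k1, k2⟩
  -- The one answer of `σ` outside `ρ` is `p' ++ [c', d']`, and the escape at `p' ++ [c']` dominates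
  -- it.
  have hle : σ ≤ (ρ.addCell hcell).union (ρ.addCell hcell') hcoh := by
    intro s hs
    rw [hσ] at hs
    rcases hs with ⟨hs, hne1⟩ | rfl
    · by_cases hne2 : s = p' ++ [c', d']
      · exact ⟨p' ++ [c'], Or.inr (Or.inr rfl), Or.inr ⟨hcell'.odd, ⟨[d'], by simp [hne2]⟩⟩⟩
      · exact ⟨s, Or.inl (Or.inl (hmemρ s hs hne1 hne2)), PlayLE.refl s⟩
    · exact ⟨_, Or.inl (Or.inr rfl), PlayLE.refl _⟩
  have hta : t ++ [a] ∈ (f ((ρ.addCell hcell).union (ρ.addCell hcell') hcoh)).plays := by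
    obtain ⟨u, hu, ⟨h', -⟩ | ⟨ho, hp⟩⟩ := hc.monotone hle _ htr.1
    · exact absurd (even_length_concat.1 h') (Nat.not_odd_iff_even.2 he)
    · exact concat_mem_of_odd_prefix he
        (map_incl hc hb ((incl_addCells _).trans (incl_union_left hcoh)) htρ) hu ho hp
  have fin : ∀ {p p' : List A.Move} {c d c' d' : A.Move} {σ σ' : Strat A},
      p' ++ [c', d'] ∈ E.plays → σ.plays = (E.plays \ {p ++ [c, d]}) ∪ {p ++ [c]} →
      σ'.evenPart.plays = E.plays \ {p' ++ [c', d']} →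
      p ++ [c, d] ≠ p' ++ [c', d'] → ρ.Incl σ → ρ.Incl σ'.evenPart → (σ, t ++ [a]) ∈ tr f →
      ∀ hcell : ρ.IsCell (p ++ [c]), t ++ [a] ∉ (f (ρ.addCell hcell)).plays := by
    intro p p' c d c' d' σ σ' hq' hσ hev' hne hρσ hρσ' htr hcell hta
    have hincl : (ρ.addCell hcell).Incl σ := by
      rintro s (hs | rfl)
      exacts [hρσ hs, hσ ▸ Or.inr rfl]
    have h1 : p' ++ [c', d'] ∈ σ.plays := hσ ▸ Or.inl ⟨hq', Ne.symm hne⟩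
    rcases htr.2 _ (Incl.compat hincl).symm hta h1 with h2 | h2
    · have := hρσ' h2
      rw [hev'] at this
      exact this.2 rfl
    · have ho := hcell.odd
      rw [← (show p' ++ [c', d'] = p ++ [c] from h2)] at ho
      exact Nat.not_even_iff_odd.2 ho (hE _ hq')
  rw [hb.map_union] at hta
  rcases hta with hta | hta
  · exact fin hq' hσ hev' hne (inter_incl_left.trans evenPart_incl) inter_incl_right htr hcell hta
  · exact fin hq hσ' hev (Ne.symm hne) (inter_incl_right.trans evenPart_incl) inter_incl_left
      htr' hcell' hta

theorem sequential_of_mem_tr (hc : ScottContinuous f) (hb : IsBistable Coh Coh f)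
    {t : List B.Move} {a : B.Move} (he : Even t.length)
    (hτ : (∃ b, (τ, t ++ [a, b]) ∈ tr f) ∨ (τ, t ++ [a]) ∈ tr f) :
    (τ.evenPart, t) ∈ tr f ∨
      ∃! q : List A.Move, q ∈ τ.evenPart.plays ∧ ∃ p c d, q = p ++ [c, d] ∧
        ∃ σ : Strat A, σ.plays = (τ.evenPart.plays \ {q}) ∪ {p ++ [c]} ∧
          (σ, t ++ [a]) ∈ tr f := by
  refine (exists_query_of_mem_tr hc hb he hτ).imp id ?_
  rintro ⟨q, p, c, d, hq, rfl, σ, hσ, htr⟩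
  refine ⟨p ++ [c, d], ⟨hq, p, c, d, rfl, σ, hσ, htr⟩, ?_⟩
  rintro _ ⟨hq', p', c', d', rfl, σ', hσ', htr'⟩
  exact (query_unique hc hb he (E := τ.evenPart) (fun _ h => h.2) hq hq' hσ hσ' htr htr').symm

end Stable

/-! ### Legal sequences -/

theorem Polarity.swap_eq_O {p : Polarity} : p.swap = .O ↔ p ≠ .O := by
  cases p <;> simp [Polarity.swap]

theorem Polarity.ne_iff {p q : Polarity} : p ≠ q ↔ (p = .O ↔ q ≠ .O) := by
  cases p <;> cases q <;> simp

theorem IsLegal.label_eq {M : Type u} {label : M → Polarity} {s : List M} :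
    ∀ {m : M}, IsLegal label (s ++ [m]) → (label m = .O ↔ Even s.length) := by
  induction s using List.reverseRecOn with
  | nil =>
    intro m h
    simpa using h.2.2 m (by simp)
  | append_singleton s k ih =>
    intro m h
    have hk := ih (h.of_prefix (List.prefix_append _ _))
    have hne : label k ≠ label m := by
      have := h.1
      rw [List.append_assoc, List.singleton_append] at this
      exact (List.isChain_append.1 this).2.1.rel
    rw [even_length_concat, ← Nat.not_even_iff_odd, ← hk, Polarity.ne_iff.1 hne, not_not]

theorem isLegal_concat {M : Type u} {label : M → Polarity} {s : List M} {m : M} :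
    IsLegal label (s ++ [m]) ↔
      IsLegal label s ∧ m ∉ s ∧ (label m = .O ↔ Even s.length) := by
  refine ⟨fun h => ⟨h.of_prefix (List.prefix_append _ _), fun hm => ?_, h.label_eq⟩, ?_⟩
  · have := h.2.1
    rw [List.nodup_append] at this
    exact this.2.2 m hm m (by simp) rfl
  · rintro ⟨h, hm, hl⟩
    refine ⟨?_, ?_, ?_⟩
    · refine List.isChain_append.2 ⟨h.1, by simp, ?_⟩
      rcases List.eq_nil_or_concat' s with rfl | ⟨s, k, rfl⟩
      · simp
      · have hk := h.label_eq
        rw [even_length_concat, ← Nat.not_even_iff_odd, ← hk] at hl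
        simpa using Polarity.ne_iff.2 (by rw [Ne, hl, not_not])
    · rw [List.nodup_append]
      refine ⟨h.2.1, by simp, ?_⟩
      rintro a ha b hb rfl
      rw [List.mem_singleton] at hb
      exact hm (hb ▸ ha)
    · cases s with
      | nil => simpa using hl
      | cons a s => simpa using h.2.2

/-! ### Plays of `!A` -/

section Bang

variable {A : Game.{u}}

theorem bangLabel_eq_O (q : BangMove A) : bangLabel A q = .O ↔ Odd q.1.length := by
  obtain ⟨q, hq, hne⟩ := q
  rcases List.eq_nil_or_concat' q with rfl | ⟨p, a, rfl⟩
  · exact absurd rfl hne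
  · rw [odd_length_concat, ← (A.legal _ hq).label_eq]
    simp [bangLabel]

theorem odd_length_iff_of_concat {L : List (BangMove A)} {q : BangMove A}
    (h : L ++ [q] ∈ (bang A).plays) : Odd q.1.length ↔ Even L.length := by
  rw [← bangLabel_eq_O]
  exact IsLegal.label_eq h.1

theorem mem_bangSet {L : List (BangMove A)} {p : List A.Move} :
    p ∈ bangSet L ↔ p = [] ∨ ∃ (t : List (BangMove A)) (m : BangMove A),
      m.1 = p ∧ EvenPrefix (t ++ [m]) L := Iff.rfl

theorem bangSet_concat {L : List (BangMove A)} (hL : Even L.length) (q : BangMove A) :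
    bangSet (L ++ [q]) = insert q.1 (bangSet L) := by
  ext p
  simp only [mem_bangSet, Set.mem_insert_iff]
  constructor
  · rintro (rfl | ⟨t, m, rfl, ⟨h, he⟩ | h⟩)
    · exact Or.inr (Or.inl rfl)
    · rcases List.prefix_concat_iff.1 h with h' | h'
      · rw [h', even_length_concat] at he
        exact absurd hL (Nat.not_even_iff_odd.2 he)
      · exact Or.inr (Or.inr ⟨t, m, rfl, Or.inl ⟨h', he⟩⟩)
    · obtain ⟨-, h⟩ := List.append_inj' h rfl
      simp only [List.cons.injEq, and_true] at h
      exact Or.inl (by rw [h])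
  · rintro (rfl | rfl | ⟨t, m, rfl, h⟩)
    · exact Or.inr ⟨L, q, rfl, Or.inr rfl⟩
    · exact Or.inl rfl
    · refine Or.inr ⟨t, m, rfl, Or.inl ⟨h.isPrefix.trans (List.prefix_append _ _), ?_⟩⟩
      rcases h with ⟨-, h⟩ | h
      exacts [h, h ▸ hL]

/-- A pending query counts as an escape only while it is pending: `q` has an odd-length initial
segment, which is discarded once `r` is played. -/
theorem bangSet_concat_concat {L : List (BangMove A)} (hL : Even L.length) (q r : BangMove A) :
    bangSet (L ++ [q] ++ [r]) = insert r.1 (bangSet L) := by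
  ext p
  simp only [mem_bangSet, Set.mem_insert_iff]
  have hlen : Even (L ++ [q] ++ [r]).length := by
    rw [even_length_concat, odd_length_concat]
    exact hL
  constructor
  · rintro (rfl | ⟨t, m, rfl, h⟩)
    · exact Or.inr (Or.inl rfl)
    · have he : Even (t ++ [m]).length := by
        rcases h with ⟨-, h⟩ | h
        exacts [h, h ▸ hlen]
      rcases List.prefix_concat_iff.1 h.isPrefix with h' | h'
      · obtain ⟨-, h⟩ := List.append_inj' h' rfl
        simp only [List.cons.injEq, and_true] at h
        exact Or.inl (by rw [h])
      · rcases List.prefix_concat_iff.1 h' with h' | h'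
        · rw [h', even_length_concat] at he
          exact absurd hL (Nat.not_even_iff_odd.2 he)
        · exact Or.inr (Or.inr ⟨t, m, rfl, Or.inl ⟨h', he⟩⟩)
  · rintro (rfl | rfl | ⟨t, m, rfl, h⟩)
    · exact Or.inr ⟨_, r, rfl, Or.inr rfl⟩
    · exact Or.inl rfl
    · refine Or.inr ⟨t, m, rfl, Or.inl ⟨h.isPrefix.trans ⟨[q, r], by simp⟩, ?_⟩⟩
      rcases h with ⟨-, h⟩ | h
      exacts [h, h ▸ hL]

theorem mem_bangSet_iff_of_even {L : List (BangMove A)} (hL : L ∈ (bang A).plays)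
    {m : BangMove A} (hm : Even m.1.length) : m.1 ∈ bangSet L ↔ m ∈ L := by
  rw [mem_bangSet]
  constructor
  · rintro (h | ⟨t, m', h, h'⟩)
    · exact absurd h m.2.2
    · obtain rfl := Subtype.ext h
      exact h'.isPrefix.subset (by simp)
  · intro h
    obtain ⟨t, r, rfl⟩ := List.append_of_mem h
    have hp : t ++ [m] <+: t ++ m :: r := ⟨r, by simp⟩
    have := odd_length_iff_of_concat ((bang A).prefix_closed _ _ hp hL)
    refine Or.inr ⟨t, m, rfl, Or.inl ⟨hp, even_length_concat.2 ?_⟩⟩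
    rw [← Nat.not_even_iff_odd, ← this, Nat.not_odd_iff_even]
    exact hm

theorem even_of_mem_bangSet {L : List (BangMove A)} (hL : L ∈ (bang A).plays)
    (he : Even L.length) {p : List A.Move} (hp : p ∈ bangSet L) : Even p.length := by
  rcases hp with rfl | ⟨t, m, rfl, h⟩
  · simp
  · have he' : Even (t ++ [m]).length := by
      rcases h with ⟨-, h⟩ | h
      exacts [h, h ▸ he]
    have := odd_length_iff_of_concat ((bang A).prefix_closed _ _ h.isPrefix hL)
    rw [← Nat.not_odd_iff_even, this, Nat.not_even_iff_odd]
    exact even_length_concat.1 he'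

theorem concat_mem_bang_iff {L : List (BangMove A)} (hL : Even L.length) {q : BangMove A} :
    L ++ [q] ∈ (bang A).plays ↔ L ∈ (bang A).plays ∧ q ∉ L ∧ Odd q.1.length ∧
      IsStrategy A (insert q.1 (bangSet L)) := by
  rw [← bangSet_concat hL]
  constructor
  · intro h
    exact ⟨(bang A).prefix_closed _ _ (List.prefix_append _ _) h, (isLegal_concat.1 h.1).2.1,
      (odd_length_iff_of_concat h).2 hL, h.2.1 _ List.prefix_rfl⟩
  · rintro ⟨h, hq, ho, hs⟩
    refine ⟨isLegal_concat.2 ⟨h.1, hq, ?_⟩, fun t ht => ?_, fun t q' r he ht => ?_⟩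
    · exact iff_of_true ((bangLabel_eq_O q).2 ho) hL
    · rcases List.prefix_concat_iff.1 ht with rfl | ht
      exacts [hs, h.2.1 t ht]
    · rcases List.prefix_concat_iff.1 ht with ht | ht
      · have := congrArg List.length ht
        simp only [List.length_append, List.length_cons, List.length_nil] at this
        rw [show L.length = t.length + 1 by omega, Nat.even_add_one] at hL
        exact absurd he hL
      · exact h.2.2 t q' r he ht

theorem concat_concat_mem_bang_iff {L : List (BangMove A)} (hL : Even L.length)
    {q r : BangMove A} : L ++ [q] ++ [r] ∈ (bang A).plays ↔ L ++ [q] ∈ (bang A).plays ∧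
      r ∉ L ∧ (∃ b, r.1 = q.1 ++ [b]) ∧ IsStrategy A (insert r.1 (bangSet L)) := by
  rw [← bangSet_concat_concat hL q r]
  constructor
  · intro h
    refine ⟨(bang A).prefix_closed _ _ (List.prefix_append _ _) h,
      fun hr => (isLegal_concat.1 h.1).2.1 (List.mem_append_left _ hr),
      h.2.2 L q r hL (by simp), h.2.1 _ List.prefix_rfl⟩
  · rintro ⟨h, hr, ⟨b, hb⟩, hs⟩
    have hqo := (odd_length_iff_of_concat h).2 hL
    refine ⟨isLegal_concat.2 ⟨h.1, ?_, ?_⟩, fun t ht => ?_, fun t q' r' he ht => ?_⟩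
    · intro hr'
      rcases List.mem_append.1 hr' with hr' | hr'
      · exact hr hr'
      · rw [List.mem_singleton] at hr'
        simp [hr'] at hb
    · have : ¬ Odd r.1.length := by
        rw [hb, odd_length_concat, Nat.not_even_iff_odd]
        exact hqo
      refine iff_of_false (fun h => this ((bangLabel_eq_O r).1 h)) ?_
      rw [even_length_concat, Nat.not_odd_iff_even]
      exact hL
    · rcases List.prefix_concat_iff.1 ht with rfl | ht
      exacts [hs, h.2.1 t ht]
    · rcases List.prefix_concat_iff.1 ht with ht | ht
      · have : t ++ [q', r'] = t ++ [q'] ++ [r'] := by simp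
        rw [this] at ht
        obtain ⟨h1, h2⟩ := List.append_inj' ht rfl
        obtain ⟨-, h3⟩ := List.append_inj' h1 rfl
        simp only [List.cons.injEq, and_true] at h2 h3
        exact ⟨b, by rw [h2, h3, hb]⟩
      · exact h.2.2 t q' r' he ht

end Bang

/-! ### Plays of `A ⇒ B` -/

section Fn

variable {A B : Game.{u}}

/-- A move of `A ⇒ B` in the argument. -/
abbrev argMove (q : BangMove A) : (fn A B).Move := (Sum.inl q : BangMove A ⊕ B.Move)

/-- A move of `A ⇒ B` in the result. -/
abbrev resMove (b : B.Move) : (fn A B).Move := (Sum.inr b : BangMove A ⊕ B.Move)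

/-- `s ↾ !A`. -/
def argSeq (s : List (fn A B).Move) : List (BangMove A) :=
  restrictLeft (M := BangMove A) (N := B.Move) s

theorem move_cases (m : (fn A B).Move) : (∃ q, m = argMove q) ∨ ∃ b, m = resMove b :=
  match (m : BangMove A ⊕ B.Move) with
  | .inl q => Or.inl ⟨q, rfl⟩
  | .inr b => Or.inr ⟨b, rfl⟩

theorem argSeq_append (s t : List (fn A B).Move) : argSeq (s ++ t) = argSeq s ++ argSeq t :=
  List.filterMap_append

theorem resPlay_append (s t : List (fn A B).Move) : resPlay (s ++ t) = resPlay s ++ resPlay t :=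
  List.filterMap_append

@[simp] theorem argSeq_nil : argSeq ([] : List (fn A B).Move) = [] := rfl

@[simp] theorem resPlay_nil : resPlay ([] : List (fn A B).Move) = [] := rfl

@[simp] theorem argSeq_cons_arg (q : BangMove A) (s : List (fn A B).Move) :
    argSeq (argMove q :: s) = q :: argSeq s := rfl

@[simp] theorem argSeq_cons_res (b : B.Move) (s : List (fn A B).Move) :
    argSeq (resMove b :: s) = argSeq s := rfl

@[simp] theorem resPlay_cons_arg (q : BangMove A) (s : List (fn A B).Move) :
    resPlay (argMove q :: s) = resPlay s := rfl

@[simp] theorem resPlay_cons_res (b : B.Move) (s : List (fn A B).Move) :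
    resPlay (resMove b :: s) = b :: resPlay s := rfl

theorem argSeq_concat_arg (s : List (fn A B).Move) (q : BangMove A) :
    argSeq (s ++ [argMove q]) = argSeq s ++ [q] := by simp [argSeq_append]

theorem argSeq_concat_res (s : List (fn A B).Move) (b : B.Move) :
    argSeq (s ++ [resMove b]) = argSeq s := by simp [argSeq_append]

theorem resPlay_concat_arg (s : List (fn A B).Move) (q : BangMove A) :
    resPlay (s ++ [argMove q]) = resPlay s := by simp [resPlay_append]

theorem resPlay_concat_res (s : List (fn A B).Move) (b : B.Move) :
    resPlay (s ++ [resMove b]) = resPlay s ++ [b] := by simp [resPlay_append]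

theorem argPlays_eq (s : List (fn A B).Move) : argPlays s = bangSet (argSeq s) := rfl

theorem argPlays_concat_res (s : List (fn A B).Move) (b : B.Move) :
    argPlays (s ++ [resMove b]) = argPlays s := by
  rw [argPlays_eq, argSeq_concat_res, argPlays_eq]

theorem length_eq (s : List (fn A B).Move) :
    s.length = (argSeq s).length + (resPlay s).length := by
  induction s with
  | nil => rfl
  | cons m s ih =>
    rcases move_cases m with ⟨q, rfl⟩ | ⟨b, rfl⟩
    · simp [ih]
      omega
    · simp [ih]
      omega

theorem argMove_mem {s : List (fn A B).Move} {q : BangMove A} :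
    argMove q ∈ s ↔ q ∈ argSeq s := by
  induction s with
  | nil => simp
  | cons m s ih =>
    rcases move_cases m with ⟨q', rfl⟩ | ⟨b, rfl⟩
    · rw [List.mem_cons, ih, argSeq_cons_arg, List.mem_cons]
      exact or_congr_left Sum.inl_injective.eq_iff
    · rw [List.mem_cons, ih, argSeq_cons_res]
      exact or_iff_right Sum.inl_ne_inr

theorem resMove_mem {s : List (fn A B).Move} {b : B.Move} :
    resMove b ∈ s ↔ b ∈ resPlay s := by
  induction s with
  | nil => simp
  | cons m s ih =>
    rcases move_cases m with ⟨q, rfl⟩ | ⟨b', rfl⟩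
    · rw [List.mem_cons, ih, resPlay_cons_arg]
      exact or_iff_right Sum.inr_ne_inl
    · rw [List.mem_cons, ih, resPlay_cons_res, List.mem_cons]
      exact or_congr_left Sum.inr_injective.eq_iff

theorem mem_fn_plays {s : List (fn A B).Move} : s ∈ (fn A B).plays ↔
    IsLegal (fn A B).label s ∧ argSeq s ∈ (bang A).plays ∧ resPlay s ∈ B.plays := Iff.rfl

/-- The labels of the argument are reversed and the lengths of the two restrictions add up, so
alternation reduces to the parity of the result. -/
theorem concat_arg_mem_iff {s : List (fn A B).Move} {q : BangMove A} :
    s ++ [argMove q] ∈ (fn A B).plays ↔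
      s ∈ (fn A B).plays ∧ argSeq s ++ [q] ∈ (bang A).plays ∧ Odd (resPlay s).length := by
  simp only [mem_fn_plays, argSeq_concat_arg, resPlay_concat_arg, isLegal_concat, argMove_mem]
  have key : argSeq s ++ [q] ∈ (bang A).plays →
      (((fn A B).label (argMove q) = .O ↔ Even s.length) ↔ Odd (resPlay s).length) := by
    intro h
    have h1 : (fn A B).label (argMove q) = (bangLabel A q).swap := rfl
    rw [h1, Polarity.swap_eq_O, Ne, bangLabel_eq_O, odd_length_iff_of_concat h, length_eq,
      Nat.even_add, ← Nat.not_even_iff_odd]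
    tauto
  constructor
  · rintro ⟨⟨h1, -, h2⟩, h3, h4⟩
    exact ⟨⟨h1, (bang A).prefix_closed _ _ (List.prefix_append _ _) h3, h4⟩, h3, (key h3).1 h2⟩
  · rintro ⟨⟨h1, -, h2⟩, h3, h4⟩
    exact ⟨⟨h1, (isLegal_concat.1 h3.1).2.1, (key h3).2 h4⟩, h3, h2⟩

theorem concat_res_mem_iff {s : List (fn A B).Move} {b : B.Move} :
    s ++ [resMove b] ∈ (fn A B).plays ↔
      s ∈ (fn A B).plays ∧ resPlay s ++ [b] ∈ B.plays ∧ Even (argSeq s).length := by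
  simp only [mem_fn_plays, argSeq_concat_res, resPlay_concat_res, isLegal_concat, resMove_mem]
  have key : resPlay s ++ [b] ∈ B.plays →
      (((fn A B).label (resMove b) = .O ↔ Even s.length) ↔ Even (argSeq s).length) := by
    intro h
    have h1 : (fn A B).label (resMove b) = B.label b := rfl
    rw [h1, (B.legal _ h).label_eq, length_eq, Nat.even_add]
    tauto
  constructor
  · rintro ⟨⟨h1, -, h2⟩, h3, h4⟩
    exact ⟨⟨h1, h3, B.prefix_closed _ _ (List.prefix_append _ _) h4⟩, h4, (key h4).1 h2⟩
  · rintro ⟨⟨h1, h2, -⟩, h3, h4⟩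
    exact ⟨⟨h1, (isLegal_concat.1 (B.legal _ h3)).2.1, (key h3).2 h4⟩, h2, h3⟩

/-- The switching condition. -/
theorem even_argSeq_or_odd_resPlay {s : List (fn A B).Move} :
    s ∈ (fn A B).plays → Even (argSeq s).length ∨ Odd (resPlay s).length := by
  rcases List.eq_nil_or_concat' s with rfl | ⟨s, m, rfl⟩
  · simp
  · rcases move_cases m with ⟨q, rfl⟩ | ⟨b, rfl⟩
    · rw [concat_arg_mem_iff, resPlay_concat_arg]
      exact fun h => Or.inr h.2.2
    · rw [concat_res_mem_iff, argSeq_concat_res]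
      exact fun h => Or.inl h.2.2

theorem even_argSeq_of_even_resPlay {s : List (fn A B).Move} (hs : s ∈ (fn A B).plays)
    (h : Even (resPlay s).length) : Even (argSeq s).length :=
  (even_argSeq_or_odd_resPlay hs).resolve_right (Nat.not_odd_iff_even.2 h)

theorem isStrategy_argPlays {s : List (fn A B).Move} (hs : s ∈ (fn A B).plays) :
    IsStrategy A (argPlays s) :=
  (mem_fn_plays.1 hs).2.1.2.1 _ List.prefix_rfl

/-- The strategy `|s ↾ !A|ᴱ`. -/
def argStrat (s : List (fn A B).Move) (hs : s ∈ (fn A B).plays) : Strat A :=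
  ⟨argPlays s, isStrategy_argPlays hs⟩

theorem mem_argPlays_iff {s : List (fn A B).Move} (hs : s ∈ (fn A B).plays) {m : BangMove A}
    (hm : Even m.1.length) : m.1 ∈ argPlays s ↔ m ∈ argSeq s :=
  mem_bangSet_iff_of_even (mem_fn_plays.1 hs).2.1 hm

theorem even_of_mem_argPlays {s : List (fn A B).Move} (hs : s ∈ (fn A B).plays)
    (he : Even (argSeq s).length) {p : List A.Move} (hp : p ∈ argPlays s) : Even p.length :=
  even_of_mem_bangSet (mem_fn_plays.1 hs).2.1 he hp

theorem mem_argPlays_of_prefix {s w : List (fn A B).Move} (hs : s ∈ (fn A B).plays)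
    (hw : w <+: s) {p : List A.Move} (hp : p ∈ argPlays w) (he : Even p.length) :
    p ∈ argPlays s := by
  have hwp := (fn A B).prefix_closed _ _ hw hs
  by_cases h0 : p = []
  · exact Or.inl h0
  · have hpA := (isStrategy_argPlays hwp).subset_plays hp
    have := (mem_argPlays_iff (m := ⟨p, hpA, h0⟩) hwp he).1 hp
    refine (mem_argPlays_iff (m := ⟨p, hpA, h0⟩) hs he).2 ?_
    exact (hw.filterMap _).subset this

theorem argPlays_subset_of_prefix {s w : List (fn A B).Move} (hs : s ∈ (fn A B).plays)
    (hw : w <+: s) (he : Even (argSeq w).length) : argPlays w ⊆ argPlays s := fun _ hp =>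
  mem_argPlays_of_prefix hs hw hp
    (even_of_mem_argPlays ((fn A B).prefix_closed _ _ hw hs) he hp)

theorem argPlays_concat_arg {s : List (fn A B).Move} (he : Even (argSeq s).length)
    (q : BangMove A) : argPlays (s ++ [argMove q]) = insert q.1 (argPlays s) := by
  rw [argPlays_eq, argSeq_concat_arg, bangSet_concat he, argPlays_eq]

theorem concat_query_mem_iff {s : List (fn A B).Move} (he : Even (argSeq s).length)
    {q : BangMove A} : s ++ [argMove q] ∈ (fn A B).plays ↔ s ∈ (fn A B).plays ∧
      Odd (resPlay s).length ∧ q ∉ argSeq s ∧ Odd q.1.length ∧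
        IsStrategy A (insert q.1 (argPlays s)) := by
  rw [concat_arg_mem_iff, concat_mem_bang_iff he, argPlays_eq]
  constructor
  · rintro ⟨h1, ⟨-, h3, h4, h5⟩, h6⟩
    exact ⟨h1, h6, h3, h4, h5⟩
  · rintro ⟨h1, h6, h3, h4, h5⟩
    exact ⟨h1, ⟨(mem_fn_plays.1 h1).2.1, h3, h4, h5⟩, h6⟩

/-- The pending query of a play with an odd number of moves in the argument. -/
theorem exists_query {s : List (fn A B).Move} (hs : s ∈ (fn A B).plays)
    (ho : Odd (argSeq s).length) : ∃ q : BangMove A, q ∈ argSeq s ∧ Odd q.1.length ∧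
      argPlays s = insert q.1 {p ∈ argPlays s | Even p.length} ∧
      ∀ r : BangMove A,
        argPlays (s ++ [argMove r]) = insert r.1 {p ∈ argPlays s | Even p.length} ∧
        (s ++ [argMove r] ∈ (fn A B).plays ↔ (∃ b, r.1 = q.1 ++ [b]) ∧ r ∉ argSeq s ∧
          IsStrategy A (insert r.1 {p ∈ argPlays s | Even p.length})) := by
  obtain ⟨L, q, hL, he⟩ := exists_eq_concat_of_odd ho
  have hb := (mem_fn_plays.1 hs).2.1
  have hres : Odd (resPlay s).length :=
    (even_argSeq_or_odd_resPlay hs).resolve_left (Nat.not_even_iff_odd.2 ho)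
  rw [hL] at hb
  have hLb := (bang A).prefix_closed _ _ (List.prefix_append _ _) hb
  have hq := (odd_length_iff_of_concat hb).2 he
  have h1 : argPlays s = insert q.1 (bangSet L) := by
    rw [argPlays_eq, hL, bangSet_concat he]
  have h2 : {p ∈ argPlays s | Even p.length} = bangSet L := by
    ext p
    rw [h1]
    constructor
    · rintro ⟨rfl | h, h'⟩
      exacts [absurd h' (Nat.not_even_iff_odd.2 hq), h]
    · exact fun h => ⟨Or.inr h, even_of_mem_bangSet hLb he h⟩
  refine ⟨q, by simp [hL], hq, by rw [h2, h1], fun r => ⟨?_, ?_⟩⟩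
  · rw [h2, argPlays_eq, argSeq_concat_arg, hL, bangSet_concat_concat he]
  · rw [h2, concat_arg_mem_iff, hL, concat_concat_mem_bang_iff he]
    constructor
    · rintro ⟨-, ⟨-, h3, ⟨b, h4⟩, h5⟩, -⟩
      refine ⟨⟨b, h4⟩, fun h => ?_, h5⟩
      rcases List.mem_append.1 h with h | h
      · exact h3 h
      · rw [List.mem_singleton] at h
        simp [h] at h4
    · rintro ⟨h3, h4, h5⟩
      exact ⟨hs, ⟨hb, fun h => h4 (List.mem_append_left _ h), h3, h5⟩, hres⟩

end Fn

/-! ### Application of sequential algorithms -/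

section App

variable {A B : Game.{u}}

theorem finite_argPlays (s : List (fn A B).Move) : (argPlays s).Finite := by
  refine ((Set.finite_singleton []).union
    ((List.finite_toSet (argSeq s)).image Subtype.val)).subset ?_
  rintro p (rfl | ⟨t, m, rfl, h⟩)
  · exact Or.inl rfl
  · exact Or.inr ⟨m, h.isPrefix.subset (by simp), rfl⟩

theorem exists_prefix_resPlay {s : List (fn A B).Move} {t : List B.Move} (h : t <+: resPlay s) :
    ∃ w, w <+: s ∧ resPlay w = t :=
  (List.prefix_filterMap_iff.1 h).imp fun _ hw => ⟨hw.1, hw.2.symm⟩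

/-- In the presence of a bound for the arguments, two plays of a sequential algorithm are equal,
or branch in the result at a position where Opponent is to move. -/
theorem eq_or_resPlay_branch (σ : Strat (fn A B)) (ρ : Strat A) {s₁ s₂ : List (fn A B).Move}
    (h₁ : s₁ ∈ σ.plays) (h₂ : s₂ ∈ σ.plays) (hρ₁ : argPlays s₁ ⊆ ρ.plays)
    (hρ₂ : argPlays s₂ ⊆ ρ.plays) :
    s₁ = s₂ ∨ ∃ v r r', Even v.length ∧ resPlay s₁ = v ++ r ∧ resPlay s₂ = v ++ r' ∧
      r.head? ≠ r'.head? := by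
  rcases eq_or_exists_common_prefix s₁ s₂ with rfl | ⟨w, r, r', rfl, rfl, hne⟩
  · exact Or.inl rfl
  have hw : Even w.length := by
    obtain ⟨h, h'⟩ := σ.isStrategy.even_branching _ h₁ _ h₂ w (isLongestCommonPrefix_append hne)
    rcases h with ⟨-, h⟩ | h
    · exact h
    · rcases h' with ⟨-, h'⟩ | h'
      · exact h'
      · rw [List.self_eq_append_right] at h h'
        exact absurd (by rw [h, h']) hne
  have hpl : ∀ r, w ++ r ∈ σ.plays → w ++ r ∈ (fn A B).plays := fun r h =>
    σ.isStrategy.subset_plays h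
  have hwp : w ∈ (fn A B).plays := (fn A B).prefix_closed _ _ (List.prefix_append _ _) (hpl r h₁)
  have hnext : ∀ {m r}, w ++ m :: r ∈ σ.plays → w ++ [m] ∈ (fn A B).plays := fun {m r} h =>
    (fn A B).prefix_closed _ _ ⟨r, by simp⟩ (hpl _ h)
  -- At a pending query both plays would have to continue with the reaction of `ρ`, which is an
  -- escape or a unique answer, and hence would not branch.
  have heven : Even (argSeq w).length := by
    by_contra ho
    obtain ⟨q, -, hqo, hq, hr⟩ := exists_query hwp (Nat.not_even_iff_odd.1 ho)
    have key : ∀ r, w ++ r ∈ σ.plays → argPlays (w ++ r) ⊆ ρ.plays →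
        (r = [] ∧ q.1 ∈ ρ.plays) ∨
          ∃ m b, r.head? = some (argMove m) ∧ m.1 = q.1 ++ [b] ∧ m.1 ∈ ρ.plays := by
      intro r hmem hsub
      cases r with
      | nil =>
        refine Or.inl ⟨rfl, hsub ?_⟩
        rw [List.append_nil, hq]
        exact Or.inl rfl
      | cons m r =>
        have hm := hnext hmem
        rcases move_cases m with ⟨m, rfl⟩ | ⟨b, rfl⟩
        · obtain ⟨hargs, hiff⟩ := hr m
          obtain ⟨⟨b, hb⟩, -, -⟩ := hiff.1 hm
          refine Or.inr ⟨m, b, rfl, hb, hsub ?_⟩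
          refine mem_argPlays_of_prefix (hpl _ hmem) (w := w ++ [argMove m]) ⟨r, by simp⟩ ?_ ?_
          · rw [hargs]
            exact Or.inl rfl
          · rw [hb]
            exact even_length_concat.2 hqo
        · exact absurd (concat_res_mem_iff.1 hm).2.2 ho
    rcases key r h₁ hρ₁ with ⟨h, hqρ⟩ | ⟨m, b, h, hb, hmρ⟩ <;>
      rcases key r' h₂ hρ₂ with ⟨h', hqρ'⟩ | ⟨m', b', h', hb', hmρ'⟩
    · exact hne (by rw [h, h'])
    · exact ρ.isStrategy.notMem_of_concat_mem hqo (hb' ▸ hmρ') hqρ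
    · exact ρ.isStrategy.notMem_of_concat_mem hqo (hb ▸ hmρ) hqρ'
    · have := ρ.isStrategy.concat_inj hqo (hb ▸ hmρ) (hb' ▸ hmρ')
      rw [h, h', Subtype.ext (hb.trans (by rw [this, ← hb']) : m.1 = m'.1)] at hne
      exact hne rfl
  have hres : Even (resPlay w).length := by
    rw [length_eq, Nat.even_add] at hw
    exact hw.1 heven
  refine Or.inr ⟨resPlay w, resPlay r, resPlay r', hres, resPlay_append _ _, resPlay_append _ _, ?_⟩
  have key : ∀ r, w ++ r ∈ σ.plays → (r = [] ∧ (resPlay r).head? = none) ∨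
      ∃ b, r.head? = some (resMove b) ∧ (resPlay r).head? = some b := by
    intro r hmem
    cases r with
    | nil => exact Or.inl ⟨rfl, rfl⟩
    | cons m r =>
      have hm := hnext hmem
      rcases move_cases m with ⟨m, rfl⟩ | ⟨b, rfl⟩
      · exact absurd hres (Nat.not_even_iff_odd.2 (concat_arg_mem_iff.1 hm).2.2)
      · exact Or.inr ⟨b, rfl, rfl⟩
  rcases key r h₁ with ⟨h, k⟩ | ⟨b, h, k⟩ <;> rcases key r' h₂ with ⟨h', k'⟩ | ⟨b', h', k'⟩
  · exact absurd (by rw [h, h']) hne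
  · simp [k, k']
  · simp [k, k']
  · rw [k, k']
    intro hb
    rw [h, h', Option.some.inj hb] at hne
    exact hne rfl

theorem eq_of_resPlay_eq (σ : Strat (fn A B)) (ρ : Strat A) {s₁ s₂ : List (fn A B).Move}
    (h₁ : s₁ ∈ σ.plays) (h₂ : s₂ ∈ σ.plays) (hρ₁ : argPlays s₁ ⊆ ρ.plays)
    (hρ₂ : argPlays s₂ ⊆ ρ.plays) (h : resPlay s₁ = resPlay s₂) : s₁ = s₂ := by
  rcases eq_or_resPlay_branch σ ρ h₁ h₂ hρ₁ hρ₂ with h' | ⟨v, r, r', -, h1, h2, hne⟩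
  · exact h'
  · rw [h1, h2, List.append_cancel_left_eq] at h
    exact absurd (by rw [h]) hne

/-- The strategy `σ · τ`. -/
def appStrat (σ : Strat (fn A B)) (τ : Strat A) : Strat B where
  plays := app σ τ
  isStrategy := by
    have hsub : app σ τ ⊆ B.plays := by
      rintro _ ⟨s, hs, -, rfl⟩
      exact (mem_fn_plays.1 (σ.isStrategy.subset_plays hs)).2.2
    have hbr : ∀ w x, Odd w.length → w ++ [x] ∈ app σ τ → ∀ t ∈ app σ τ, w <+: t →
        w ++ [x] <+: t := by
      rintro w x ho ⟨s₁, h₁, k₁, e₁⟩ t ⟨s₂, h₂, k₂, rfl⟩ hwt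
      rcases eq_or_resPlay_branch σ τ h₁ h₂ k₁ k₂ with rfl | ⟨v, r, r', hv, h1, h2, hne⟩
      · rw [e₁]
      · have hlcp := isLongestCommonPrefix_append (w := v) hne
        rw [← h1, ← h2, e₁] at hlcp
        have hwv := hlcp.2.2 w (List.prefix_append _ _) hwt
        obtain ⟨y, hy⟩ := exists_concat_prefix hwv (by
          rintro rfl
          exact Nat.not_even_iff_odd.2 ho hv)
        obtain rfl := eq_of_concat_prefix List.prefix_rfl (hy.trans hlcp.1)
        exact hy.trans hlcp.2.1
    refine .of_det hsub ⟨[], σ.isStrategy.nil_mem, ?_, rfl⟩ ?_ ?_ ?_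
    · rw [argPlays_eq, argSeq_nil, bangSet_nil, Set.singleton_subset_iff]
      exact τ.isStrategy.nil_mem
    · rintro t _ ht he ⟨s, hs, k, rfl⟩
      obtain ⟨w, hw, rfl⟩ := exists_prefix_resPlay ht
      have hsp := σ.isStrategy.subset_plays hs
      have he' := even_argSeq_of_even_resPlay ((fn A B).prefix_closed _ _ hw hsp) he
      refine ⟨w, mem_of_even_prefix hs hw ?_, (argPlays_subset_of_prefix hsp hw he').trans k, rfl⟩
      rw [length_eq]
      exact he'.add he
    · intro w x ho hx hw
      have := (hbr w x ho hx w hw List.prefix_rfl).length_le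
      simp at this
    · intro w x y ho hx hy
      simpa using (hbr w x ho hx _ hy (List.prefix_append _ _)).eq_of_length (by simp)

theorem Realizes.eq_appStrat {σ : Strat (fn A B)} {f : Strat A → Strat B} (h : Realizes σ f) :
    f = appStrat σ := funext fun τ => Strat.ext (h τ)

theorem realizes_appStrat (σ : Strat (fn A B)) : Realizes σ (appStrat σ) := fun _ => rfl

theorem eq_of_odd_prefix_of_even_mem {S : Set (List A.Move)} (hS : IsStrategy A S) {τ : Strat A}
    (hτ : ∀ p ∈ S, Even p.length → p ∈ τ.plays) {u q : List A.Move} (hq : q ∈ S)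
    (hqo : Odd q.length) (hu : u ∈ τ.plays) (huo : Odd u.length) (h : u <+: q) : u = q := by
  obtain ⟨p, c, rfl, hp⟩ := exists_eq_concat_of_odd hqo
  refine odd_prefix_of_prefix_concat h fun h' => ?_
  have hpS := hS.mem_of_even_prefix hq (List.prefix_append _ _) hp
  rw [eq_of_odd_prefix hu (hτ p hpS hp) huo h'] at huo
  exact Nat.not_even_iff_odd.2 huo hp

/-- The play is run against `τ'` instead of `τ`. The first answer that `τ'` does not share is
replaced by an escape, which can only be at the pending query; the output then escapes at the prefix
reached. -/
theorem even_mem_or_exists_escape {τ τ' : Strat A} (hle : τ ≤ τ') (s : List (fn A B).Move) :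
    s ∈ (fn A B).plays → (∀ p ∈ argPlays s, Even p.length → p ∈ τ.plays) →
    (∀ p ∈ argPlays s, Even p.length → p ∈ τ'.plays) ∨
      ∃ s', s' <+: s ∧ Even s'.length ∧ Odd (resPlay s').length ∧ argPlays s' ⊆ τ'.plays := by
  induction s using List.reverseRecOn with
  | nil =>
    refine fun _ _ => Or.inl fun p hp _ => ?_
    rw [argPlays_eq, argSeq_nil, bangSet_nil] at hp
    rw [hp]
    exact τ'.isStrategy.nil_mem
  | append_singleton s m ih =>
    intro hsm hτ
    have hpre : s <+: s ++ [m] := List.prefix_append _ _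
    have hs := (fn A B).prefix_closed _ _ hpre hsm
    rcases ih hs fun p hp he => hτ p (mem_argPlays_of_prefix hsm hpre hp he) he with
      h | ⟨s', h1, h2⟩
    swap
    · exact Or.inr ⟨s', h1.trans hpre, h2⟩
    rcases move_cases m with ⟨r, rfl⟩ | ⟨b, rfl⟩
    swap
    · rw [argPlays_concat_res]
      exact Or.inl h
    rcases Nat.even_or_odd (argSeq s).length with he | ho
    · left
      rw [argPlays_concat_arg he]
      rintro p (rfl | hp) hpe
      · exact absurd hpe (Nat.not_even_iff_odd.2 ((concat_query_mem_iff he).1 hsm).2.2.2.1)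
      · exact h p hp hpe
    · obtain ⟨q, -, hqo, hq, hr⟩ := exists_query hs ho
      obtain ⟨hargs, hiff⟩ := hr r
      obtain ⟨⟨b, hb⟩, -, -⟩ := hiff.1 hsm
      have hre : Even r.1.length := hb ▸ even_length_concat.2 hqo
      have hrτ : r.1 ∈ τ.plays := hτ r.1 (hargs ▸ Or.inl rfl) hre
      obtain ⟨t, ht, ⟨-, hp⟩ | ⟨hto, hp⟩⟩ := hle r.1 hrτ
      · left
        rw [hargs]
        rintro p (rfl | hp') hpe
        · exact mem_of_even_prefix ht hp hre
        · exact h p hp'.1 hpe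
      · right
        have htq : t <+: q.1 := by
          rw [hb] at hp
          refine (List.prefix_concat_iff.1 hp).resolve_left fun h' => ?_
          rw [h', ← hb] at hto
          exact Nat.not_even_iff_odd.2 hto hre
        have hqs : q.1 ∈ argPlays s := by
          rw [hq]
          exact Or.inl rfl
        obtain rfl := eq_of_odd_prefix_of_even_mem (isStrategy_argPlays hs) h hqs hqo ht hto htq
        have hres := (even_argSeq_or_odd_resPlay hs).resolve_left (Nat.not_even_iff_odd.2 ho)
        refine ⟨s, hpre, ?_, hres, ?_⟩
        · rw [length_eq]
          exact ho.add_odd hres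
        · rw [hq]
          exact Set.insert_subset ht fun p hp => h p hp.1 hp.2

theorem appStrat_mono (σ : Strat (fn A B)) : Monotone (appStrat σ) := by
  rintro τ τ' hle _ ⟨s, hs, hsτ, rfl⟩
  have hsp := σ.isStrategy.subset_plays hs
  rcases even_mem_or_exists_escape hle s hsp fun p hp _ => hsτ hp with h | ⟨s', h1, h2, h3, h4⟩
  · refine ⟨resPlay s, ⟨s, hs, ?_, rfl⟩, PlayLE.refl _⟩
    intro p hp
    rcases Nat.even_or_odd p.length with he | ho
    · exact h p hp he
    · obtain ⟨t, ht, ⟨he, -⟩ | ⟨hto, hpre⟩⟩ := hle p (hsτ hp)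
      · exact absurd he (Nat.not_even_iff_odd.2 ho)
      · rwa [← eq_of_odd_prefix_of_even_mem (isStrategy_argPlays hsp) h hp ho ht hto hpre]
  · exact ⟨resPlay s', ⟨s', mem_of_even_prefix hs h1 h2, h4, rfl⟩,
      Or.inr ⟨h3, h1.filterMap _⟩⟩

theorem Strat.exists_subset_of_finite {X : Set (Strat A)} (h0 : X.Nonempty)
    (hX : DirectedOn (· ≤ ·) X) {τ : Strat A} (hτ : IsLUB X τ) {F : Set (List A.Move)}
    (hF : F.Finite) (hFτ : F ⊆ τ.plays) : ∃ σ ∈ X, ∀ σ' ∈ X, σ ≤ σ' → F ⊆ σ'.plays := by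
  induction F, hF using Set.Finite.induction_on with
  | empty => exact h0.imp fun σ hσ => ⟨hσ, fun _ _ _ => Set.empty_subset _⟩
  | insert _ _ ih =>
    obtain ⟨σ₁, h₁, k₁⟩ := ih ((Set.subset_insert _ _).trans hFτ)
    obtain ⟨σ₂, h₂, k₂⟩ := (mem_lub_iff h0 hX hτ).1 (hFτ (Set.mem_insert _ _))
    obtain ⟨σ, hσ, l₁, l₂⟩ := hX σ₁ h₁ σ₂ h₂
    exact ⟨σ, hσ, fun σ' hσ' h => Set.insert_subset (k₂ σ' hσ' (l₂.trans h))
      (k₁ σ' hσ' (l₁.trans h))⟩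

/-- A play inspects only finitely many plays of its argument, so a single element of the directed
set supplies them all. -/
theorem scottContinuous_appStrat (σ : Strat (fn A B)) : ScottContinuous (appStrat σ) := by
  intro X h0 hX τ hτ
  constructor
  · rintro _ ⟨x, hx, rfl⟩
    exact appStrat_mono σ (hτ.1 hx)
  · rintro ρ hρ _ ⟨s, hs, hsτ, rfl⟩
    obtain ⟨x, hx, h⟩ := exists_subset_of_finite h0 hX hτ (finite_argPlays s) hsτ
    exact hρ ⟨x, hx, rfl⟩ _ ⟨s, hs, h x hx le_rfl, rfl⟩

theorem coh_appStrat (σ : Strat (fn A B)) {τ τ' : Strat A} (h : τ.Coh τ') :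
    (appStrat σ τ).Coh (appStrat σ τ') := by
  have key : ∀ {τ τ' : Strat A}, τ.Coh τ' → ∀ t : List B.Move, Even t.length →
      t ∈ (appStrat σ τ).plays → t ∈ (appStrat σ τ').plays := by
    rintro τ τ' h _ he ⟨s, hs, hsτ, rfl⟩
    have hsp := σ.isStrategy.subset_plays hs
    exact ⟨s, hs, fun p hp => h.mem (hsτ hp)
      (even_of_mem_argPlays hsp (even_argSeq_of_even_resPlay hsp he) hp), rfl⟩
  exact coh_of_forall fun t he => ⟨key h t he, key h.symm t he⟩

/-- Witnesses of the same output for `τ` and for `τ'` coincide, because `τ ∪ τ'` bounds both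
arguments. -/
theorem appStrat_inter (σ : Strat (fn A B)) {τ τ' : Strat A} (h : τ.Coh τ') :
    appStrat σ (τ.inter τ') = (appStrat σ τ).inter (appStrat σ τ') := by
  refine Strat.ext (Set.Subset.antisymm ?_ ?_)
  · rintro _ ⟨s, hs, hsτ, rfl⟩
    exact ⟨⟨s, hs, hsτ.trans Set.inter_subset_left, rfl⟩,
      ⟨s, hs, hsτ.trans Set.inter_subset_right, rfl⟩⟩
  · rintro _ ⟨⟨s, hs, hsτ, rfl⟩, ⟨s', hs', hsτ', heq⟩⟩
    obtain rfl := eq_of_resPlay_eq σ (τ.union τ' h) hs' hs (hsτ'.trans (incl_union_right h))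
      (hsτ.trans (incl_union_left h)) heq
    exact ⟨s', hs, Set.subset_inter hsτ hsτ', rfl⟩

/-- A play uses at most one escape of its argument, the pending query, so that `τ` or `τ'` alone
provides all that it needs. -/
theorem appStrat_union (σ : Strat (fn A B)) {τ τ' : Strat A} (h : τ.Coh τ') :
    appStrat σ (τ.union τ' h) =
      (appStrat σ τ).union (appStrat σ τ') (coh_appStrat σ h) := by
  refine Strat.ext (Set.Subset.antisymm ?_ ?_)
  · rintro _ ⟨s, hs, hsτ, rfl⟩
    have hsp := σ.isStrategy.subset_plays hs
    have hev : ∀ p ∈ argPlays s, Even p.length → p ∈ τ.plays ∧ p ∈ τ'.plays := fun p hp he =>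
      (hsτ hp).elim (fun hp => ⟨hp, h.mem hp he⟩) fun hp => ⟨h.symm.mem hp he, hp⟩
    rcases Nat.even_or_odd (argSeq s).length with he | ho
    · exact Or.inl ⟨s, hs, fun p hp => (hev p hp (even_of_mem_argPlays hsp he hp)).1, rfl⟩
    · obtain ⟨q, -, -, hq, -⟩ := exists_query hsp ho
      have hqs : q.1 ∈ argPlays s := by
        rw [hq]
        exact Or.inl rfl
      rcases hsτ hqs with hqτ | hqτ
      · refine Or.inl ⟨s, hs, ?_, rfl⟩
        rw [hq]
        exact Set.insert_subset hqτ fun p hp => (hev p hp.1 hp.2).1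
      · refine Or.inr ⟨s, hs, ?_, rfl⟩
        rw [hq]
        exact Set.insert_subset hqτ fun p hp => (hev p hp.1 hp.2).2
  · rintro _ (⟨s, hs, hsτ, rfl⟩ | ⟨s, hs, hsτ, rfl⟩)
    exacts [⟨s, hs, hsτ.trans (incl_union_left h), rfl⟩,
      ⟨s, hs, hsτ.trans (incl_union_right h), rfl⟩]

theorem isBistable_appStrat (σ : Strat (fn A B)) : IsBistable Coh Coh (appStrat σ) := by
  intro τ τ' h
  refine ⟨coh_appStrat σ h, fun m hm => ?_, fun j hj => ?_⟩
  · rw [hm.unique h.isGLB_inter, appStrat_inter σ h]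
    exact (coh_appStrat σ h).isGLB_inter
  · rw [hj.unique h.isLUB_union, appStrat_union σ h]
    exact (coh_appStrat σ h).isLUB_union

end App

/-! ### Sequentialization of the trace -/

section SeqTrace

variable {A B : Game.{u}} {f : Strat A → Strat B}

theorem evenPrefix_concat {M : Type u} {s t : List M} {x : M}
    (h : EvenPrefix t (s ++ [x])) : EvenPrefix t s ∨ t = s ++ [x] := by
  rcases h with ⟨h, he⟩ | h
  · rcases List.prefix_concat_iff.1 h with h | h
    exacts [Or.inr h, Or.inl (Or.inl ⟨h, he⟩)]
  · exact Or.inr h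

theorem evenPrefix_concat_concat_of_even {M : Type u} {s t : List M} {x y : M}
    (hs : Even s.length) (h : EvenPrefix t (s ++ [x] ++ [y])) :
    EvenPrefix t s ∨ t = s ++ [x] ++ [y] := by
  rcases h with ⟨h, he⟩ | h
  · rcases List.prefix_concat_iff.1 h with h | h
    · exact Or.inr h
    · rcases List.prefix_concat_iff.1 h with h | h
      · rw [h, even_length_concat] at he
        exact absurd hs (Nat.not_even_iff_odd.2 he)
      · exact Or.inl (Or.inl ⟨h, he⟩)
  · exact Or.inr h

theorem seqTrace_evenPrefix_closed {s t : List (fn A B).Move} (h : EvenPrefix s t)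
    (ht : t ∈ seqTrace f) : s ∈ seqTrace f :=
  ⟨(fn A B).prefix_closed _ _ h.isPrefix ht.1, fun r hr => ht.2 r (hr.trans h)⟩

theorem seqTrace_concat {s : List (fn A B).Move} {x : (fn A B).Move} (hs : s ∈ seqTrace f)
    (hx : s ++ [x] ∈ (fn A B).plays)
    (htr : ∃ τ : Strat A, τ.plays = argPlays (s ++ [x]) ∧ (τ, resPlay (s ++ [x])) ∈ tr f) :
    s ++ [x] ∈ seqTrace f := by
  refine ⟨hx, fun t ht => ?_⟩
  rcases evenPrefix_concat ht with ht | rfl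
  exacts [hs.2 t ht, htr]

theorem seqTrace_concat_concat {s : List (fn A B).Move} {x y : (fn A B).Move}
    (hs : s ∈ seqTrace f) (he : Even s.length) (hx : s ++ [x] ++ [y] ∈ (fn A B).plays)
    (htr : ∃ τ : Strat A, τ.plays = argPlays (s ++ [x] ++ [y]) ∧
      (τ, resPlay (s ++ [x] ++ [y])) ∈ tr f) :
    s ++ [x] ++ [y] ∈ seqTrace f := by
  refine ⟨hx, fun t ht => ?_⟩
  rcases evenPrefix_concat_concat_of_even he ht with ht | rfl
  exacts [hs.2 t ht, htr]

theorem parity_of_odd_length {s : List (fn A B).Move} (hs : s ∈ (fn A B).plays)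
    (ho : Odd s.length) : Even (argSeq s).length ∧ Odd (resPlay s).length := by
  rw [length_eq, Nat.odd_add] at ho
  rcases even_argSeq_or_odd_resPlay hs with h | h
  · refine ⟨h, ?_⟩
    rw [← Nat.not_even_iff_odd, ← ho, Nat.not_odd_iff_even]
    exact h
  · refine ⟨?_, h⟩
    rw [← Nat.not_odd_iff_even, ho, Nat.not_even_iff_odd]
    exact h

/-- The possible reactions of the sequentialized trace to an Opponent move. -/
theorem reaction_of_concat_mem_seqTrace {w : List (fn A B).Move} {x : (fn A B).Move}
    (ho : Odd w.length) (hw : w ∈ (fn A B).plays) (hx : w ++ [x] ∈ seqTrace f) :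
    (∃ b, x = resMove b ∧ (argStrat w hw, resPlay w ++ [b]) ∈ tr f) ∨
    ∃ q : BangMove A, x = argMove q ∧ q.1 ∉ argPlays w ∧ ∃ σ : Strat A,
      σ.plays = insert q.1 (argPlays w) ∧ (argStrat w hw).Coh σ ∧ (σ, resPlay w) ∈ tr f := by
  obtain ⟨he, -⟩ := parity_of_odd_length hw ho
  obtain ⟨σ, hσ, htr⟩ := hx.2 _ (Or.inr rfl)
  rcases move_cases x with ⟨q, rfl⟩ | ⟨b, rfl⟩
  · rw [resPlay_concat_arg] at htr
    rw [argPlays_concat_arg he] at hσ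
    have hq : Odd q.1.length := ((concat_query_mem_iff he).1 hx.1).2.2.2.1
    refine Or.inr ⟨q, rfl, fun h => ?_, σ, hσ, coh_of_forall fun s hs => ?_, htr⟩
    · exact Nat.not_even_iff_odd.2 hq (even_of_mem_argPlays hw he h)
    · rw [hσ, Set.mem_insert_iff, or_iff_right]
      · rfl
      · rintro rfl
        exact Nat.not_even_iff_odd.2 hq hs
  · rw [resPlay_concat_res] at htr
    rw [argPlays_concat_res] at hσ
    obtain rfl : σ = argStrat w hw := Strat.ext hσ
    exact Or.inl ⟨b, rfl, htr⟩

theorem singleton_nil_mem_tr (f : Strat A → Strat B) :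
    ((⟨{[]}, isStrategy_singleton_nil A⟩ : Strat A), []) ∈ tr f := by
  refine ⟨(f _).isStrategy.nil_mem, fun τ _ _ => ?_⟩
  rintro _ rfl
  exact τ.isStrategy.nil_mem

theorem nil_mem_seqTrace (f : Strat A → Strat B) : [] ∈ seqTrace f := by
  refine ⟨(fn A B).nil_mem, fun t ht => ?_⟩
  obtain rfl : t = [] := List.prefix_nil.1 ht.isPrefix
  exact ⟨⟨{[]}, isStrategy_singleton_nil A⟩, bangSet_nil.symm, singleton_nil_mem_tr f⟩

/-- All reactions at one position come from tokens with coherent arguments. Their union is a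
legitimate argument, so outputs cannot conflict, and tokens with equal outputs are equal by
`tr_unique`. -/
theorem isStrategy_seqTrace (hc : ScottContinuous f) (hb : IsBistable Coh Coh f) :
    IsStrategy (fn A B) (seqTrace f) := by
  have separate : ∀ {σ τ : Strat A} {t : List B.Move} {b : B.Move}, Odd t.length → σ.Coh τ →
      t ++ [b] ∈ (f σ).plays → t ∉ (f τ).plays := by
    intro σ τ t b ho h h1 h2
    exact (f (σ.union τ h)).isStrategy.notMem_of_concat_mem ho
      (map_incl hc hb (incl_union_left h) h1) (map_incl hc hb (incl_union_right h) h2)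
  refine .of_det (fun s hs => hs.1) (nil_mem_seqTrace f)
    (fun s t h he ht => seqTrace_evenPrefix_closed (Or.inl ⟨h, he⟩) ht) ?_ ?_
  · intro w x ho hx hw
    obtain ⟨σ, hσ, htr⟩ := hw.2 _ (Or.inr rfl)
    obtain rfl : σ = argStrat w hw.1 := Strat.ext hσ
    obtain ⟨-, hres⟩ := parity_of_odd_length hw.1 ho
    rcases reaction_of_concat_mem_seqTrace ho hw.1 hx with
      ⟨b, rfl, h⟩ | ⟨q, rfl, hq, τ, hτ, hcoh, h⟩
    · exact separate hres rfl h.1 htr.1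
    · rw [← tr_unique htr h hcoh.compat] at hτ
      exact hq (hτ.symm ▸ Or.inl rfl : q.1 ∈ (argStrat w hw.1).plays)
  · intro w x y ho hx hy
    have hw := (fn A B).prefix_closed _ _ (List.prefix_append _ _) hx.1
    obtain ⟨-, hres⟩ := parity_of_odd_length hw ho
    rcases reaction_of_concat_mem_seqTrace ho hw hx with
        ⟨b, rfl, h⟩ | ⟨q, rfl, hq, τ, hτ, hcoh, h⟩ <;>
      rcases reaction_of_concat_mem_seqTrace ho hw hy with
        ⟨b', rfl, h'⟩ | ⟨q', rfl, hq', τ', hτ', hcoh', h'⟩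
    · rw [(f _).isStrategy.concat_inj hres h.1 h'.1]
    · exact absurd h'.1 (separate hres hcoh' h.1)
    · exact absurd h.1 (separate hres hcoh h'.1)
    · have heq := tr_unique h h' (hcoh.symm.trans hcoh').compat
      have hmem : q.1 ∈ τ'.plays := by
        rw [← heq, hτ]
        exact Or.inl rfl
      rw [hτ'] at hmem
      rw [Subtype.ext (hmem.resolve_right hq)]

/-- In a play of `!A` of even length all Opponent moves are answered. -/
theorem exists_answer {L : List (BangMove A)} (hL : L ∈ (bang A).plays) (he : Even L.length)
    {q : BangMove A} (hq : q ∈ L) (hqo : Odd q.1.length) : ∃ b, q.1 ++ [b] ∈ bangSet L := by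
  obtain ⟨t, r, rfl⟩ := List.append_of_mem hq
  have hpre : t ++ [q] <+: t ++ q :: r := ⟨r, by simp⟩
  have ht : Even t.length := by
    rw [← odd_length_iff_of_concat (q := q) ((bang A).prefix_closed _ _ hpre hL)]
    exact hqo
  cases r with
  | nil =>
    rw [even_length_concat] at he
    exact absurd ht (Nat.not_even_iff_odd.2 he)
  | cons m r =>
    obtain ⟨b, hb⟩ := hL.2.2 t q m ht ⟨r, by simp⟩
    refine ⟨b, ?_⟩
    rw [← hb, mem_bangSet_iff_of_even hL]
    · simp
    · rw [hb]
      exact even_length_concat.2 hqo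

/-- A trace token with non-empty output arises from a play of the sequentialized trace by one
Opponent move, which is the last input or the answer to the last query, and a reaction to it. -/
theorem exists_mem_seqTrace_of_reaction (hc : ScottContinuous f) (hb : IsBistable Coh Coh f)
    {τ : Strat A} {t : List B.Move} {a : B.Move} (he : Even t.length)
    (hτ : (∃ b, (τ, t ++ [a, b]) ∈ tr f) ∨ (τ, t ++ [a]) ∈ tr f)
    (ih : ∀ (σ : Strat A) (r : List B.Move),
      r.length + σ.evenPart.plays.ncard < (t ++ [a]).length + τ.evenPart.plays.ncard →
      (σ, r) ∈ tr f → ∃ s ∈ seqTrace f, argPlays s = σ.plays ∧ resPlay s = r) :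
    ∃ s x, s ∈ seqTrace f ∧ Even s.length ∧ s ++ [x] ∈ (fn A B).plays ∧
      argPlays (s ++ [x]) = τ.evenPart.plays ∧ resPlay (s ++ [x]) = t ++ [a] := by
  rcases exists_query_of_mem_tr hc hb he hτ with htr | ⟨q, p, c, d, hq, rfl, σ, hσ, htr⟩
  · obtain ⟨s, hs, hargs, hres⟩ := ih τ.evenPart t (by
      rw [show τ.evenPart.evenPart = τ.evenPart from coh_evenPart.symm]
      simp) htr
    have hse := even_argSeq_of_even_resPlay hs.1 (hres ▸ he)
    refine ⟨s, resMove a, hs, ?_, concat_res_mem_iff.2 ⟨hs.1, ?_, hse⟩, ?_, ?_⟩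
    · rw [length_eq, hres]
      exact hse.add he
    · rw [hres]
      rcases hτ with ⟨b, hτ⟩ | hτ
      · exact B.prefix_closed _ _ ⟨[b], by simp⟩ ((f τ).isStrategy.subset_plays hτ.1)
      · exact (f τ).isStrategy.subset_plays hτ.1
    · rw [argPlays_concat_res, hargs]
    · rw [resPlay_concat_res, hres]
  · have hpcd : p ++ [c, d] = p ++ [c] ++ [d] := by simp
    have hp : Even p.length := by
      have := hq.2
      rwa [hpcd, even_length_concat, odd_length_concat] at this
    have hpc : Odd (p ++ [c]).length := odd_length_concat.2 hp
    have hev : σ.evenPart.plays = τ.evenPart.plays \ {p ++ [c, d]} := by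
      ext s
      constructor
      · rintro ⟨hs, hse⟩
        rw [hσ] at hs
        rcases hs with hs | rfl
        exacts [hs, absurd hse (Nat.not_even_iff_odd.2 hpc)]
      · intro hs
        exact ⟨hσ ▸ Or.inl hs, hs.1.2⟩
    have hfin : τ.evenPart.plays.Finite := by
      rcases hτ with ⟨b, hτ⟩ | hτ
      exacts [(finite_of_mem_tr hc hb hτ).subset evenPart_incl,
        (finite_of_mem_tr hc hb hτ).subset evenPart_incl]
    -- The output keeps its length, but the answer to the last query has been removed, so the
    -- measure drops.
    obtain ⟨s, hs, hargs, hres⟩ := ih σ (t ++ [a]) (by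
      rw [hev]
      exact Nat.add_lt_add_left (Set.ncard_sdiff_singleton_lt_of_mem hq hfin) _) htr
    have hpcs : p ++ [c] ∈ argPlays s := by
      rw [hargs, hσ]
      exact Or.inr rfl
    have hso : Odd (argSeq s).length := by
      rw [← Nat.not_even_iff_odd]
      exact fun h => Nat.not_even_iff_odd.2 hpc (even_of_mem_argPlays hs.1 h hpcs)
    have hro : Odd (resPlay s).length := by
      rw [hres]
      exact odd_length_concat.2 he
    obtain ⟨q, -, hqo, hq', hr⟩ := exists_query hs.1 hso
    have hevs : {p ∈ argPlays s | Even p.length} = τ.evenPart.plays \ {p ++ [c, d]} := by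
      rw [hargs]
      exact hev
    have hqeq : p ++ [c] = q.1 := by
      rw [hq'] at hpcs
      exact hpcs.resolve_right fun h => Nat.not_even_iff_odd.2 hpc h.2
    let r : BangMove A := ⟨p ++ [c, d], τ.isStrategy.subset_plays hq.1, by simp⟩
    obtain ⟨h1, h2⟩ := hr r
    have hins : insert r.1 (τ.evenPart.plays \ {p ++ [c, d]}) = τ.evenPart.plays :=
      Set.insert_sdiff_self_of_mem hq
    rw [hevs, hins] at h1 h2
    refine ⟨s, argMove r, hs, ?_, h2.2 ⟨⟨d, ?_⟩, fun hmem => ?_, τ.evenPart.isStrategy⟩, h1, ?_⟩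
    · rw [length_eq]
      exact hso.add_odd hro
    · rw [← hqeq]
      exact hpcd
    · have : r.1 ∈ {p ∈ argPlays s | Even p.length} :=
        ⟨(mem_argPlays_iff hs.1 hq.2).2 hmem, hq.2⟩
      rw [hevs] at this
      exact this.2 rfl
    · rw [resPlay_concat_arg, hres]

/-- The measure adds the length of the output to the number of answers in the argument, since
undoing an input shortens the former and undoing a query lowers the latter. -/
theorem exists_mem_seqTrace (hc : ScottContinuous f) (hb : IsBistable Coh Coh f) :
    ∀ (n : ℕ) (τ : Strat A) (t : List B.Move), t.length + τ.evenPart.plays.ncard = n →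
      (τ, t) ∈ tr f → ∃ s ∈ seqTrace f, argPlays s = τ.plays ∧ resPlay s = t := by
  intro n
  induction n using Nat.strong_induction_on with
  | _ n ih =>
    intro τ t hn htr
    rcases Nat.even_or_odd t.length with he | ho
    · rcases List.eq_nil_or_concat' t with rfl | ⟨t, b, rfl⟩
      · refine ⟨[], nil_mem_seqTrace f, ?_, rfl⟩
        rw [← tr_unique (singleton_nil_mem_tr f) htr (Incl.compat ?_)]
        · exact bangSet_nil
        · rintro _ rfl
          exact τ.isStrategy.nil_mem
      · obtain ⟨t, a, rfl, he'⟩ := exists_eq_concat_of_odd (even_length_concat.1 he)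
        have hab : t ++ [a] ++ [b] = t ++ [a, b] := by simp
        have hτ := eq_evenPart_of_mem_tr hb htr he
        obtain ⟨s, x, hs, hse, hx, hargs, hres⟩ := exists_mem_seqTrace_of_reaction hc hb he'
          (Or.inl ⟨b, hab ▸ htr⟩) fun σ r hlt h => ih _ (by
            rw [← hn, List.length_append]
            omega) σ r rfl h
        have hxe := (parity_of_odd_length hx (odd_length_concat.2 hse)).1
        refine ⟨s ++ [x] ++ [resMove b], seqTrace_concat_concat hs hse ?_ ⟨τ, ?_, ?_⟩, ?_, ?_⟩
        · refine concat_res_mem_iff.2 ⟨hx, ?_, hxe⟩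
          rw [hres]
          exact (f τ).isStrategy.subset_plays htr.1
        · rw [argPlays_concat_res, hargs, ← hτ]
        · rw [resPlay_concat_res, hres]
          exact htr
        · rw [argPlays_concat_res, hargs, ← hτ]
        · rw [resPlay_concat_res, hres]
    · obtain ⟨t, a, rfl, he⟩ := exists_eq_concat_of_odd ho
      obtain ⟨s, x, hs, hse, hx, hargs, hres⟩ := exists_mem_seqTrace_of_reaction hc hb he
        (Or.inr htr) fun σ r hlt h => ih _ (hn ▸ hlt) σ r rfl h
      obtain ⟨hxe, hxo⟩ := parity_of_odd_length hx (odd_length_concat.2 hse)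
      -- An escaping output has two sources: the algorithm itself escapes, or it asks the one query
      -- at which the argument escapes.
      rcases eq_evenPart_or_insert_of_mem_tr hc hb htr with hτ | ⟨q, hqo, hτ⟩
      · rw [← hτ] at hargs
        exact ⟨s ++ [x], seqTrace_concat hs hx ⟨τ, hargs.symm, hres ▸ htr⟩, hargs, hres⟩
      · have hqτ : q ∈ τ.plays := hτ ▸ Or.inl rfl
        let m : BangMove A := ⟨q, τ.isStrategy.subset_plays hqτ, by
          rintro rfl
          simp at hqo⟩
        have hargs' : argPlays (s ++ [x] ++ [argMove m]) = τ.plays := by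
          rw [argPlays_concat_arg hxe, hargs, hτ]
        refine ⟨s ++ [x] ++ [argMove m], seqTrace_concat_concat hs hse ?_ ⟨τ, hargs'.symm, ?_⟩,
          hargs', ?_⟩
        · refine (concat_query_mem_iff hxe).2 ⟨hx, hxo, fun hm => ?_, hqo, ?_⟩
          · obtain ⟨b, hb⟩ := exists_answer (mem_fn_plays.1 hx).2.1 hxe hm hqo
            rw [← argPlays_eq, hargs] at hb
            exact τ.isStrategy.notMem_of_concat_mem hqo hb.1 hqτ
          · rw [hargs, ← hτ]
            exact τ.isStrategy
        · rw [resPlay_concat_arg, hres]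
          exact htr
        · rw [resPlay_concat_arg, hres]

/-- The sequentialized trace of a continuous bistable function, as a sequential algorithm. -/
def seqTraceStrat (hc : ScottContinuous f) (hb : IsBistable Coh Coh f) : Strat (fn A B) :=
  ⟨seqTrace f, isStrategy_seqTrace hc hb⟩

theorem realizes_seqTraceStrat (hc : ScottContinuous f) (hb : IsBistable Coh Coh f) :
    Realizes (seqTraceStrat hc hb) f := by
  refine fun τ => Set.Subset.antisymm (fun t ht => ?_) ?_
  · obtain ⟨σ, hσ, -, htr⟩ := exists_mem_tr hc hb ht
    obtain ⟨s, hs, hargs, hres⟩ := exists_mem_seqTrace hc hb _ σ t rfl htr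
    exact ⟨s, hs, hargs.subset.trans hσ, hres⟩
  · rintro _ ⟨s, hs, hsτ, rfl⟩
    obtain ⟨σ, hσ, htr⟩ := hs.2 s (Or.inr rfl)
    exact map_incl hc hb (hσ.subset.trans hsτ : σ.plays ⊆ τ.plays) htr.1

/-- A sequential algorithm is determined by the function which it computes. -/
theorem Realizes.plays_eq_seqTrace {σ : Strat (fn A B)} (h : Realizes σ f) :
    σ.plays = seqTrace f := by
  obtain rfl := h.eq_appStrat
  have hsub : σ.plays ⊆ seqTrace (appStrat σ) := by
    intro s hs
    refine ⟨σ.isStrategy.subset_plays hs, fun t ht => ?_⟩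
    have htσ := σ.isStrategy.even_prefix_closed t s ht hs
    refine ⟨argStrat t (σ.isStrategy.subset_plays htσ), rfl,
      ⟨t, htσ, Set.Subset.rfl, rfl⟩, ?_⟩
    rintro τ ⟨ρ, h1, h2⟩ ⟨t', ht', hargs, hres⟩
    obtain rfl := eq_of_resPlay_eq σ ρ ht' htσ (hargs.trans h2) h1 hres
    exact hargs
  -- Both algorithms compute the same function, so `σ` has a play with the result of `s` and
  -- arguments below those of `s`; inside the larger algorithm these two plays coincide.
  refine Set.Subset.antisymm hsub fun s hs => ?_
  have hc := scottContinuous_appStrat σ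
  have hb := isBistable_appStrat σ
  have hres : resPlay s ∈ (appStrat σ (argStrat s hs.1)).plays := by
    rw [realizes_seqTraceStrat hc hb]
    exact ⟨s, hs, Set.Subset.rfl, rfl⟩
  obtain ⟨s', hs', hargs, hres'⟩ := hres
  rwa [← eq_of_resPlay_eq (seqTraceStrat hc hb) (argStrat s hs.1) (hsub hs') hs hargs
    Set.Subset.rfl hres']

/-! ### Characterization of observably sequential functions -/

theorem observablySequential_iff :
    ObservablySequential f ↔ ScottContinuous f ∧ IsBistable Coh Coh f := by
  constructor
  · rintro ⟨σ, h⟩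
    obtain rfl := h.eq_appStrat
    exact ⟨scottContinuous_appStrat σ, isBistable_appStrat σ⟩
  · rintro ⟨hc, hb⟩
    exact ⟨_, realizes_seqTraceStrat hc hb⟩

theorem IsBistable.comp {D E F : Type u} [PartialOrder D] [PartialOrder E] [PartialOrder F]
    {cohD : D → D → Prop} {cohE : E → E → Prop} {cohF : F → F → Prop} {f : D → E} {g : E → F}
    (hg : IsBistable cohE cohF g) (hf : IsBistable cohD cohE f) :
    IsBistable cohD cohF (g ∘ f) := fun x y h =>
  have hf := hf x y h
  have hg := hg _ _ hf.1
  ⟨hg.1, fun m hm => hg.2.1 _ (hf.2.1 m hm), fun j hj => hg.2.2 _ (hf.2.2 j hj)⟩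

/-! ### The embedding into bistable bicpos -/

/-- The morphism of bistable bicpos computed by a sequential algorithm. -/
def appHom (A B : Game.{u}) (σ : Strat (fn A B)) :
    stratBBC A (Strat.isBistableBicpo A) ⟶ stratBBC B (Strat.isBistableBicpo B) :=
  (⟨appStrat σ, scottContinuous_appStrat σ, isBistable_appStrat σ⟩ :
    BBC.Hom (stratBBC A (Strat.isBistableBicpo A)) (stratBBC B (Strat.isBistableBicpo B)))

theorem appHom_injective (A B : Game.{u}) : Function.Injective (appHom A B) := by
  intro σ τ h
  have heq : appStrat σ = appStrat τ := congrArg homFun h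
  refine Strat.ext ?_
  rw [(realizes_appStrat σ).plays_eq_seqTrace, heq, (realizes_appStrat τ).plays_eq_seqTrace]

theorem appHom_surjective (A B : Game.{u}) : Function.Surjective (appHom A B) := by
  intro g
  refine ⟨seqTraceStrat (f := homFun g) (BBC.Hom.continuous g) (BBC.Hom.bistable g),
    BBC.Hom.ext ?_⟩
  exact (realizes_seqTraceStrat (f := homFun g) _ _).eq_appStrat.symm

end SeqTrace

end Bistable

open Bistable

theorem mainTheorem12 :
    -- continuous bistable functions are stable, and are computed by their sequentialized trace
    (∀ (A B : Game.{u}) (f : Strat A → Strat B), ScottContinuous f →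
      IsBistable Strat.Coh Strat.Coh f →
        IsStable f ∧
        (∃ σ : Strat (fn A B), σ.plays = seqTrace f ∧ Realizes σ f) ∧
        -- sequentiality of the trace
        (∀ (τ : Strat A) (t : List B.Move) (a : B.Move), Even t.length →
          ((∃ b, (τ, t ++ [a, b]) ∈ tr f) ∨ (τ, t ++ [a]) ∈ tr f) →
            (τ.evenPart, t) ∈ tr f ∨
            ∃! q : List A.Move, q ∈ τ.evenPart.plays ∧ ∃ p c d, q = p ++ [c, d] ∧
              ∃ σ : Strat A, σ.plays = (τ.evenPart.plays \ {q}) ∪ {p ++ [c]} ∧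
                (σ, t ++ [a]) ∈ tr f)) ∧
    -- a function of SDS-biorders is observably sequential iff it is continuous and bistable
    (∀ (A B : Game.{u}) (f : Strat A → Strat B),
      ObservablySequential f ↔ ScottContinuous f ∧ IsBistable Strat.Coh Strat.Coh f) ∧
    -- observably sequential functions are closed under identities and composition
    (∀ A : Game.{u}, ObservablySequential (id : Strat A → Strat A)) ∧
    (∀ (A B C : Game.{u}) (f : Strat A → Strat B) (g : Strat B → Strat C),
      ObservablySequential f → ObservablySequential g → ObservablySequential (g ∘ f)) ∧
    -- the SDS-biorders are objects of `BBC`, and sequential data structures and sequential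
    -- algorithms form a category, fully and faithfully embedded in `BBC` by
    -- `A ↦ strat(A)`, `σ ↦ (τ ↦ σ · τ)`
    ∃ (h : ∀ A : Game.{u}, IsBistableBicpo (Strat A) Strat.Coh)
      (ident : ∀ A : Game.{u}, Strat (fn A A))
      (comp : ∀ A B C : Game.{u}, Strat (fn A B) → Strat (fn B C) → Strat (fn A C))
      (F : ∀ A B : Game.{u}, Strat (fn A B) → (stratBBC A (h A) ⟶ stratBBC B (h B))),
      (∀ A B σ, comp A A B (ident A) σ = σ) ∧
      (∀ A B σ, comp A B B σ (ident B) = σ) ∧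
      (∀ A B C D σ τ ρ,
        comp A C D (comp A B C σ τ) ρ = comp A B D σ (comp B C D τ ρ)) ∧
      (∀ A B σ, Realizes σ (homFun (F A B σ))) ∧
      (∀ A, F A A (ident A) = 𝟙 (stratBBC A (h A))) ∧
      (∀ A B C σ τ, F A C (comp A B C σ τ) = F A B σ ≫ F B C τ) ∧
      (∀ A B, Function.Injective (F A B)) ∧
      (∀ A B, Function.Surjective (F A B)) := by
  refine ⟨fun A B f hc hb => ⟨isStable_of_continuous_of_isBistable hc hb,
      ⟨seqTraceStrat hc hb, rfl, realizes_seqTraceStrat hc hb⟩,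
      fun τ t a he h => sequential_of_mem_tr hc hb he h⟩,
    fun A B f => observablySequential_iff,
    fun A => observablySequential_iff.2
      ⟨ScottContinuous.id, fun _ _ h => ⟨h, fun _ hm => hm, fun _ hj => hj⟩⟩,
    fun A B C f g hf hg => ?_, Strat.isBistableBicpo, ?_⟩
  · rw [observablySequential_iff] at hf hg ⊢
    exact ⟨ScottContinuous.comp hf.1 hg.1, hg.2.comp hf.2⟩
  · have inj := appHom_injective.{u}
    -- Identities and composition of algorithms are pulled back along the bijection `appHom`, so
    -- each category law is checked in `BBC`.
    choose inv hinv using appHom_surjective.{u}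
    refine ⟨fun A => inv A A (𝟙 _), fun A B C σ τ => inv A C (appHom A B σ ≫ appHom B C τ),
      appHom, fun A B σ => inj _ _ ?_, fun A B σ => inj _ _ ?_, fun A B C D σ τ ρ => inj _ _ ?_,
      fun A B σ => realizes_appStrat σ, fun A => hinv _ _ _, fun A B C σ τ => hinv _ _ _,
      inj, appHom_surjective⟩
    · rw [hinv, hinv, Category.id_comp]
    · rw [hinv, hinv, Category.comp_id]
    · simp only [hinv, Category.assoc]
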